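/- Let $\mathbb S^1=\mathbb R/2\pi\mathbb Z$ and $\hat v(n)=\frac1{2\pi}\int_{-\pi}^{\pi}v(x)e^{-inx}\,dx$. Let $\mathcal H$ be the Hilbert transform (Fourier multiplier $-i\,\mathrm{sgn}(n)$), $\Lambda=\mathcal H\partial_x$ (Fourier multiplier $|n|$) and $[\mathcal H,f]g=\mathcal H(fg)-f\,\mathcal Hg$. For $s\ge 0$ let $\dot H^s$ be the space of (complex-valued) $v\in L^2(\mathbb S^1)$ with zero average and $\|v\|_{\dot H^s}^2=\sum_n|n|^{2s}|\hat v(n)|^2<\infty$. Consider the Cauchy problem $$f_t+\Lambda^3 f=\partial_x[\mathcal H,f]\Lambda^3 f,\qquad f|_{t=0}=f_0. \tag{1}$$ A solution of (1) on $[0,T]$ in $L^4([0,T];\dot H^{9/4})$ is a function $f$ in this space such that, for almost every $t\in[0,T]$, $f(t)=f_0+\int_0^t\big(-\Lambda^3f+\partial_x[\mathcal H,f]\Lambda^3f\big)(\tau)\,d\tau$ in the sense of distributions on $\mathbb S^1$; for $T=\infty$ the interval $[0,T]$ is read as $[0,\infty)$. (i) For every $f_0\in\dot H^{3/2}$ there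 is a $T=T(f_0)>0$ such that (1) has a unique solution $f$ in $L^4([0,T];\dot H^{9/4})$. In addition, $f\in C([0,T];\dot H^{3/2})\cap L^2([0,T];\dot H^3)$ (for its representative that is continuous in time, which satisfies $f(0)=f_0$), and $f$ is real-valued if $f_0$ is. (ii) There is an $\varepsilon_0>0$ such that for every $f_0\in\dot H^{3/2}$ with $\|f_0\|_{\dot H^{3/2}}\le\varepsilon_0$ the conclusions of (i) hold with $T=\infty$. -/

import Mathlib

open MeasureTheory Set Filter Topology
open scoped ENNReal

noncomputable section

namespace CapillaryMuskat

/-- The one-dimensional torus `𝕊¹ = ℝ / 2πℤ`. -/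
abbrev Torus : Type := AddCircle (2 * Real.pi)

instance : Fact (0 < 2 * Real.pi) := ⟨Real.two_pi_pos⟩

/-- Square-integrable complex functions on the torus, with the normalized measure `dx / (2π)`. -/
abbrev L2 : Type := Lp ℂ 2 (AddCircle.haarAddCircle (T := 2 * Real.pi))

/-- The Fourier coefficients `û n = (1 / 2π) ∫ u(x) e^{-inx} dx`. -/
def coeff (u : L2) (n : ℤ) : ℂ := fourierCoeff (u : Torus → ℂ) n

/-! ### Operators on distributions

A periodic distribution is given by its Fourier coefficients `c : ℤ → ℂ`; all the operators below
are described by their action on these coefficients. -/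

/-- The Hilbert transform, with symbol `-i sgn n`. -/
def hilbert (c : ℤ → ℂ) (n : ℤ) : ℂ := -Complex.I * (n.sign : ℂ) * c n

/-- The derivative `∂ₓ`, with symbol `i n`. -/
def ddx (c : ℤ → ℂ) (n : ℤ) : ℂ := Complex.I * (n : ℂ) * c n

/-- The Calderón operator `Λ = ℋ ∂ₓ`, with symbol `|n|` (see `calderon_apply`). -/
def calderon (c : ℤ → ℂ) : ℤ → ℂ := hilbert (ddx c)

theorem calderon_apply (c : ℤ → ℂ) (n : ℤ) : calderon c n = ((|n| : ℤ) : ℂ) * c n := by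
  have h : ((|n| : ℤ) : ℂ) = (n.sign : ℂ) * (n : ℂ) := by
    rw [← Int.cast_mul, Int.sign_mul_self_eq_abs]
  rw [h, calderon, hilbert, ddx]
  linear_combination (-(n.sign : ℂ) * (n : ℂ) * c n) * Complex.I_mul_I

/-- The operator `Λ³`. -/
def calderonCube (c : ℤ → ℂ) : ℤ → ℂ := calderon (calderon (calderon c))

/-- The product of two distributions: the coefficients of `u v` are the convolution of those of `u`
and `v`. In the uses below the factors lie in `Ḣ^{9/4}` and `Ḣ^{-3/4}`, and the series converges
absolutely. -/
def mul (c d : ℤ → ℂ) (n : ℤ) : ℂ := ∑' k : ℤ, c k * d (n - k)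

/-- The commutator `[ℋ, f] g = ℋ (f g) - f (ℋ g)`. -/
def commHilbert (f g : ℤ → ℂ) (n : ℤ) : ℂ := hilbert (mul f g) n - mul f (hilbert g) n

/-- The right-hand side `∂ₓ [ℋ, f] Λ³ f`. -/
def nonlinearity (f : ℤ → ℂ) : ℤ → ℂ := ddx (commHilbert f (calderonCube f))

/-! ### Function spaces -/

/-- The homogeneous Sobolev norm `(∑ |n|^{2s} |û n|²)^{1/2}`, with values in `[0, ∞]`. -/
def hdotNorm (s : ℝ) (u : L2) : ℝ≥0∞ :=
  (∑' n : ℤ, ENNReal.ofReal (|(n : ℝ)| ^ (2 * s) * ‖coeff u n‖ ^ 2)) ^ (1 / 2 : ℝ)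

/-- Membership in `Ḣ^s(𝕊¹)` for `s ≥ 0`: zero average and finite `Ḣ^s` norm (for `s ≥ 0` every
distribution in `Ḣ^s` is a square-integrable function). -/
def MemHdot (s : ℝ) (u : L2) : Prop := coeff u 0 = 0 ∧ hdotNorm s u < ∞

/-- The time interval `[0, T]`, for `T ∈ [0, ∞]`; for `T = ∞` it is `[0, ∞)`. -/
def timeInterval (T : ℝ≥0∞) : Set ℝ := {t : ℝ | 0 ≤ t ∧ ENNReal.ofReal t ≤ T}

/-- `f ∈ L^p([0, T]; Ḣ^s)`, for `0 < p < ∞`. -/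
def MemLpHdot (p s : ℝ) (T : ℝ≥0∞) (f : ℝ → L2) : Prop :=
  AEStronglyMeasurable f (volume.restrict (timeInterval T)) ∧
  (∀ᵐ t ∂(volume.restrict (timeInterval T)), MemHdot s (f t)) ∧
  ∫⁻ t in timeInterval T, hdotNorm s (f t) ^ p < ∞

/-- `f ∈ C([0, T]; Ḣ^s)`. -/
def ContinuousHdot (s : ℝ) (T : ℝ≥0∞) (f : ℝ → L2) : Prop :=
  ∀ t ∈ timeInterval T, MemHdot s (f t) ∧
    Tendsto (fun τ : ℝ => hdotNorm s (f τ - f t)) (𝓝[timeInterval T] t) (𝓝 0)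

/-- `u` is real-valued. -/
def IsRealValued (u : L2) : Prop :=
  ∀ᵐ x ∂(AddCircle.haarAddCircle (T := 2 * Real.pi)), ((u : Torus → ℂ) x).im = 0

/-! ### The Cauchy problem -/

/-- `f` solves `f_t + Λ³ f = ∂ₓ [ℋ, f] Λ³ f`, `f|_{t = 0} = f₀` on `[0, T]`: the equation integrated
in time, `f(t) = f₀ + ∫₀ᵗ (-Λ³ f + ∂ₓ [ℋ, f] Λ³ f) dτ`, holds in the sense of distributions on the
torus (that is, tested against every `e^{-inx}`) for almost every `t ∈ [0, T]`. The integrands are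
locally integrable in time for every `f ∈ L⁴([0, T]; Ḣ^{9/4})`. -/
def IsSolution (T : ℝ≥0∞) (f₀ : L2) (f : ℝ → L2) : Prop :=
  ∀ᵐ t ∂(volume.restrict (timeInterval T)), ∀ n : ℤ,
    coeff (f t) n = coeff f₀ n +
      ∫ τ in (0 : ℝ)..t, (-calderonCube (coeff (f τ)) n + nonlinearity (coeff (f τ)) n)

/-- On `[0, T]` there is a solution with datum `f₀` in `L⁴([0, T]; Ḣ^{9/4})`, it is the only one in
that space (as a class of functions modulo equality at almost every time), and it lies in
`C([0, T]; Ḣ^{3/2}) ∩ L²([0, T]; Ḣ³)`, with value `f₀` at time `0`. The functions are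
complex-valued; the solution is real-valued if the datum is. -/
def UniquelySolvable (T : ℝ≥0∞) (f₀ : L2) : Prop :=
  ∃ f : ℝ → L2,
    MemLpHdot 4 (9 / 4) T f ∧ IsSolution T f₀ f ∧
    (∀ g : ℝ → L2, MemLpHdot 4 (9 / 4) T g → IsSolution T f₀ g →
      g =ᵐ[volume.restrict (timeInterval T)] f) ∧
    f 0 = f₀ ∧ ContinuousHdot (3 / 2) T f ∧ MemLpHdot 2 3 T f ∧
    (IsRealValued f₀ → ∀ t ∈ timeInterval T, IsRealValued (f t))

end CapillaryMuskat

end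

noncomputable section

namespace CapillaryMuskat

/-! ### Inequalities in `[0, ∞]` -/

/-! The equation is treated as a semilinear heat-type equation with forcing in `L²` of space-time.
The problem is scale-critical in `Ḣ^{3/2}`, so everything rests on one bilinear estimate and one
linear estimate which match exactly.

Bilinear estimate (`energy_bilinear_le`). In Fourier variables `∂ₓ[ℋ, c]Λ³d` has the symbol `n (sgn
n - sgn (n - k)) |n - k|³`, where `k` is the frequency of `c`. It vanishes unless `n` lies strictly
between `0` and `k`, and then `|n|, |n - k| ≤ |k|`. The commutator thus lets derivatives be moved
from `d` to `c`, and `|n| |n - k|³ ≤ |k|^{-1/2} |k|^{9/4} |n - k|^{9/4}`. Only about `|k|`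
frequencies `n` are involved for each `k`, which the factor `|k|^{-1/2}` compensates in square sum.
Cauchy–Schwarz gives `Ḣ^{9/4} × Ḣ^{9/4} → L²`, hence `L⁴Ḣ^{9/4} × L⁴Ḣ^{9/4} → L²L²` in time.

Linear estimate (`quarticNorm_forced_le`, `quarticNorm_free_le`). A datum in `Ḣ^{3/2}` and a forcing
in `L²L²` give a solution in `L^∞Ḣ^{3/2} ∩ L²Ḣ³`, which embeds in `L⁴Ḣ^{9/4}` by interpolation. The
constants do not depend on the time interval.

Existence (`exists_isMild`) is a contraction for the unknown forcing `F = ∂ₓ[ℋ, u]Λ³u`, with `u`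
given by Duhamel's formula. Its only smallness assumption is on the `L⁴Ḣ^{9/4}` norm of the free
evolution. This norm is small on a short interval by absolute continuity of the integral, and on
`[0, ∞)` if the datum is small.

Uniqueness holds in all of `L⁴Ḣ^{9/4}`: the bilinear estimate puts the forcing of any solution in
`L²L²`, so an integrating factor in each mode shows that the solution is mild
(`isMild_of_isSolution`). Two mild solutions agree by continuation over short intervals
(`IsMild.eq_of_isMild`). Real-valuedness follows by applying uniqueness to the complex conjugate. -/

theorem sq_lintegral_mul_le {α : Type*} [MeasurableSpace α] (μ : Measure α) {f g : α → ℝ≥0∞}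
    (hf : AEMeasurable f μ) (hg : AEMeasurable g μ) :
    (∫⁻ a, f a * g a ∂μ) ^ 2 ≤ (∫⁻ a, f a ^ 2 ∂μ) * ∫⁻ a, g a ^ 2 ∂μ := by
  have h := ENNReal.lintegral_mul_le_Lp_mul_Lq μ Real.HolderConjugate.two_two hf hg
  calc (∫⁻ a, f a * g a ∂μ) ^ 2
      ≤ ((∫⁻ a, f a ^ (2 : ℝ) ∂μ) ^ (1 / 2 : ℝ) * (∫⁻ a, g a ^ (2 : ℝ) ∂μ) ^ (1 / 2 : ℝ)) ^ 2 := by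
        gcongr; exact h
    _ = _ := by
        rw [mul_pow]
        simp only [← ENNReal.rpow_natCast, ← ENNReal.rpow_mul]
        norm_num

theorem sq_tsum_mul_le {ι : Type*} [Countable ι] (f g : ι → ℝ≥0∞) :
    (∑' i, f i * g i) ^ 2 ≤ (∑' i, f i ^ 2) * ∑' i, g i ^ 2 := by
  let _ : MeasurableSpace ι := ⊤
  have : MeasurableSingletonClass ι := ⟨fun _ => trivial⟩
  simpa only [lintegral_count] using sq_lintegral_mul_le (Measure.count : Measure ι)
    (f := f) (g := g) (measurable_from_top.aemeasurable) (measurable_from_top.aemeasurable)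

theorem enorm_add_sq_le (a b : ℂ) : ‖a + b‖ₑ ^ 2 ≤ 2 * (‖a‖ₑ ^ 2 + ‖b‖ₑ ^ 2) :=
  calc ‖a + b‖ₑ ^ 2 ≤ (‖a‖ₑ + ‖b‖ₑ) ^ 2 := by gcongr; exact enorm_add_le a b
    _ ≤ 2 * (‖a‖ₑ ^ 2 + ‖b‖ₑ ^ 2) := by
      have := ENNReal.rpow_add_le_mul_rpow_add_rpow ‖a‖ₑ ‖b‖ₑ (p := 2) (by norm_num)
      norm_num at this
      simpa [mul_add] using this

theorem add_sq_le_two_mul (a b : ℝ≥0∞) : (a + b) ^ 2 ≤ 2 * (a ^ 2 + b ^ 2) := by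
  have := ENNReal.rpow_add_le_mul_rpow_add_rpow a b (p := 2) (by norm_num)
  norm_num at this
  simpa [mul_add] using this

theorem tsum_sub_left (f : ℤ → ℝ≥0∞) (n : ℤ) : ∑' k, f (n - k) = ∑' k, f k :=
  (Equiv.subLeft n).tsum_eq f

/-! ### Weighted square sums of Fourier coefficients -/

/-- The weight `|n|^r`. -/
def weight (r : ℝ) (n : ℤ) : ℝ≥0∞ := ENNReal.ofReal (|(n : ℝ)| ^ r)

/-- The square sum `∑ |n|^r |c n|²`. -/
def sobolevSum (r : ℝ) (c : ℤ → ℂ) : ℝ≥0∞ := ∑' n, weight r n * ‖c n‖ₑ ^ 2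

/-- The square sum `∑ |c n|²`. -/
def energy (c : ℤ → ℂ) : ℝ≥0∞ := ∑' n, ‖c n‖ₑ ^ 2

theorem weight_ne_top (r : ℝ) (n : ℤ) : weight r n ≠ ∞ := ENNReal.ofReal_ne_top

theorem weight_zero_right {r : ℝ} (hr : r ≠ 0) : weight r 0 = 0 := by
  simp [weight, Real.zero_rpow hr]

theorem weight_mul {r s : ℝ} (hr : 0 < r) (hs : 0 < s) (n : ℤ) :
    weight r n * weight s n = weight (r + s) n := by
  rw [weight, weight, weight, ← ENNReal.ofReal_mul (by positivity),
    Real.rpow_add_of_nonneg (abs_nonneg _) hr.le hs.le]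

theorem weight_sq {r : ℝ} (hr : 0 < r) (n : ℤ) : weight r n ^ 2 = weight (2 * r) n := by
  rw [sq, weight_mul hr hr, two_mul]

theorem one_le_abs_cast {n : ℤ} (hn : n ≠ 0) : (1 : ℝ) ≤ |(n : ℝ)| := by
  exact_mod_cast Int.one_le_abs hn

theorem weight_mono {r s : ℝ} (hrs : r ≤ s) {n : ℤ} (hn : n ≠ 0) : weight r n ≤ weight s n :=
  ENNReal.ofReal_le_ofReal (Real.rpow_le_rpow_of_exponent_le (one_le_abs_cast hn) hrs)

theorem one_le_weight {s : ℝ} (hs : 0 ≤ s) {n : ℤ} (hn : n ≠ 0) : 1 ≤ weight s n := by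
  have := weight_mono hs hn
  simpa [weight] using this

theorem weight_three (n : ℤ) : weight 3 n = ENNReal.ofReal (|(n : ℝ)| ^ 3) := by
  rw [weight]; norm_cast

theorem hdotNorm_eq (s : ℝ) (u : L2) :
    hdotNorm s u = sobolevSum (2 * s) (coeff u) ^ (1 / 2 : ℝ) := by
  unfold hdotNorm sobolevSum weight
  congr 2; ext n
  rw [ENNReal.ofReal_mul (by positivity), ENNReal.ofReal_pow (norm_nonneg _), ofReal_norm]

theorem hdotNorm_sq (s : ℝ) (u : L2) : hdotNorm s u ^ 2 = sobolevSum (2 * s) (coeff u) := by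
  rw [hdotNorm_eq, ← ENNReal.rpow_natCast, ← ENNReal.rpow_mul]; norm_num

theorem hdotNorm_lt_top {s : ℝ} {u : L2} :
    hdotNorm s u < ∞ ↔ sobolevSum (2 * s) (coeff u) < ∞ := by
  rw [← hdotNorm_sq]; simp

/-- Cauchy–Schwarz with the weight split as `9/2 = 3/2 + 3`: `Ḣ^{9/4}` is halfway between `Ḣ^{3/2}`
and `Ḣ³`. -/
theorem sobolevSum_interpolation (c : ℤ → ℂ) :
    sobolevSum (9 / 2) c ^ 2 ≤ sobolevSum 3 c * sobolevSum 6 c := by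
  have h := sq_tsum_mul_le (fun n => weight (3 / 2) n * ‖c n‖ₑ) (fun n => weight 3 n * ‖c n‖ₑ)
  have e1 : ∀ n, weight (3 / 2) n * ‖c n‖ₑ * (weight 3 n * ‖c n‖ₑ)
      = weight (9 / 2) n * ‖c n‖ₑ ^ 2 := fun n => by
    rw [show (9 / 2 : ℝ) = 3 / 2 + 3 by norm_num, ← weight_mul (by norm_num) (by norm_num)]; ring
  have e2 : ∀ n, (weight (3 / 2) n * ‖c n‖ₑ) ^ 2 = weight 3 n * ‖c n‖ₑ ^ 2 := fun n => by
    rw [mul_pow, weight_sq (by norm_num)]; norm_num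
  have e3 : ∀ n, (weight 3 n * ‖c n‖ₑ) ^ 2 = weight 6 n * ‖c n‖ₑ ^ 2 := fun n => by
    rw [mul_pow, weight_sq (by norm_num)]; norm_num
  simp only [e1, e2, e3] at h
  exact h

theorem sobolevSum_add_le (r : ℝ) (c d : ℤ → ℂ) :
    sobolevSum r (fun n => c n + d n) ≤ 2 * (sobolevSum r c + sobolevSum r d) := by
  unfold sobolevSum
  rw [← ENNReal.tsum_add, ← ENNReal.tsum_mul_left]
  refine ENNReal.tsum_le_tsum fun n => ?_
  calc weight r n * ‖c n + d n‖ₑ ^ 2 ≤ weight r n * (2 * (‖c n‖ₑ ^ 2 + ‖d n‖ₑ ^ 2)) := by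
        gcongr; exact enorm_add_sq_le _ _
    _ = _ := by ring

theorem energy_add_le (c d : ℤ → ℂ) :
    energy (fun n => c n + d n) ≤ 2 * (energy c + energy d) := by
  unfold energy
  rw [← ENNReal.tsum_add, ← ENNReal.tsum_mul_left]
  exact ENNReal.tsum_le_tsum fun n => enorm_add_sq_le _ _

/-! ### The bilinear form of the nonlinearity -/

/-- The symbol of the nonlinearity as a bilinear operator. -/
def symbol (n k : ℤ) : ℂ := ((n * (n.sign - (n - k).sign) * |n - k| ^ 3 : ℤ) : ℂ)

/-- The bilinear operator `∂ₓ [ℋ, c] Λ³ d`. -/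
def bilinear (c d : ℤ → ℂ) (n : ℤ) : ℂ := ∑' k : ℤ, symbol n k * (c k * d (n - k))

theorem intCast_abs_eq (n : ℤ) : ((|n| : ℤ) : ℂ) = ((|(n : ℝ)| : ℝ) : ℂ) := by
  rw [← Int.cast_abs, Complex.ofReal_intCast]

theorem calderonCube_apply (c : ℤ → ℂ) (n : ℤ) :
    calderonCube c n = ((|(n : ℝ)| ^ 3 : ℝ) : ℂ) * c n := by
  simp only [calderonCube, calderon_apply, intCast_abs_eq, Complex.ofReal_pow]; ring

/-- The integers strictly between `0` and `k`. -/
def between (k : ℤ) : Finset ℤ := if 0 ≤ k then Finset.Ioo 0 k else Finset.Ioo k 0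

theorem card_between_le {k : ℤ} : ((between k).card : ℝ≥0∞) ≤ weight 1 k := by
  have : ((between k).card : ℝ) ≤ |(k : ℝ)| := by
    have : ((between k).card : ℤ) ≤ |k| := by
      unfold between; split_ifs with h
      · rw [Int.card_Ioo, abs_of_nonneg h]; omega
      · rw [Int.card_Ioo, abs_of_neg (by omega)]; omega
    exact_mod_cast this
  rw [weight, Real.rpow_one]
  calc ((between k).card : ℝ≥0∞) = ENNReal.ofReal ((between k).card : ℝ) := by simp
    _ ≤ _ := ENNReal.ofReal_le_ofReal this

/-- If `n` and `n - k` have the same sign, the commutator cancels; if one of them is zero, the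
factor `n` or `|n - k|³` vanishes. Opposite signs force `n` to lie strictly between `0` and `k`. -/
theorem symbol_eq_zero {n k : ℤ} (h : n ∉ between k) : symbol n k = 0 := by
  unfold symbol
  rw [Int.cast_eq_zero]
  rcases lt_trichotomy n 0 with hn | hn | hn
  · rcases lt_trichotomy (n - k) 0 with hm | hm | hm
    · simp [Int.sign_eq_neg_one_of_neg hn, Int.sign_eq_neg_one_of_neg hm]
    · simp [hm]
    · refine absurd ?_ h
      unfold between; rw [if_neg (by omega)]; simp; omega
  · simp [hn]
  · rcases lt_trichotomy (n - k) 0 with hm | hm | hm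
    · refine absurd ?_ h
      unfold between; rw [if_pos (by omega)]; simp; omega
    · simp [hm]
    · simp [Int.sign_eq_one_of_pos hn, Int.sign_eq_one_of_pos hm]

theorem abs_le_of_mem_between {n k : ℤ} (h : n ∈ between k) : |n| ≤ |k| ∧ |n - k| ≤ |k| ∧ k ≠ 0 := by
  unfold between at h
  split_ifs at h with hk
  · simp at h
    rw [abs_of_pos h.1, abs_of_nonneg hk, abs_of_neg (by omega)]; omega
  · simp at h
    rw [abs_of_neg h.2, abs_of_neg (by omega : k < 0), abs_of_pos (by omega)]; omega

theorem enorm_symbol_le {n k : ℤ} :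
    ‖symbol n k‖ₑ ≤ 2 * (weight 1 n * weight 3 (n - k)) := by
  have : ‖symbol n k‖ ≤ 2 * (|(n : ℝ)| * |((n - k : ℤ) : ℝ)| ^ 3) := by
    unfold symbol
    rw [Complex.norm_intCast]
    push_cast
    rw [abs_mul, abs_mul, abs_of_nonneg (a := |(n : ℝ) - k| ^ 3) (by positivity)]
    have h : |((n.sign : ℤ) : ℝ) - ((n - k).sign : ℤ)| ≤ 2 := by
      rcases Int.sign_trichotomy n with h | h | h <;>
        rcases Int.sign_trichotomy (n - k) with h' | h' | h' <;> rw [h, h'] <;> norm_num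
    calc _ ≤ |(n : ℝ)| * 2 * |(n : ℝ) - k| ^ 3 := by gcongr
      _ = _ := by ring
  rw [← ofReal_norm]
  refine (ENNReal.ofReal_le_ofReal this).trans_eq ?_
  rw [ENNReal.ofReal_mul (by norm_num), ENNReal.ofReal_mul (by positivity), weight_three, weight,
    Real.rpow_one]
  norm_num

/-- The exponents balance: `1 + 3 + 1/2 = 9/4 + 9/4`. Since `k` is the largest frequency, the whole
factor `|n|` and the power `3/4` of `|n - k|` may be moved onto it. -/
theorem weight_le_of_mem_between {n k : ℤ} (h : n ∈ between k) :
    weight 1 n * weight 3 (n - k) * weight (1 / 2) k ≤ weight (9 / 4) k * weight (9 / 4) (n - k) := by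
  obtain ⟨h1, h2, hk⟩ := abs_le_of_mem_between h
  have h1 : |(n : ℝ)| ≤ |(k : ℝ)| := by exact_mod_cast h1
  have h2 : |((n - k : ℤ) : ℝ)| ≤ |(k : ℝ)| := by exact_mod_cast h2
  have w1 : weight 1 n ≤ weight 1 k := ENNReal.ofReal_le_ofReal (by gcongr)
  have w2 : weight (3 / 4) (n - k) ≤ weight (3 / 4) k := ENNReal.ofReal_le_ofReal (by gcongr)
  calc _ = weight 1 n * weight (3 / 4) (n - k) * weight (1 / 2) k * weight (9 / 4) (n - k) := by
        rw [show (3 : ℝ) = 3 / 4 + 9 / 4 by norm_num, ← weight_mul (by norm_num) (by norm_num)]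
        norm_num; ring
    _ ≤ weight 1 k * weight (3 / 4) k * weight (1 / 2) k * weight (9 / 4) (n - k) := by gcongr
    _ = _ := by
        rw [weight_mul (by norm_num) (by norm_num), weight_mul (by norm_num) (by norm_num)]
        norm_num

/-- The kernel `|k|^{-1/2} 1_{n between 0 and k}`. -/
def kernel (n k : ℤ) : ℝ≥0∞ := if n ∈ between k then (weight (1 / 2) k)⁻¹ else 0

theorem enorm_symbol_le_kernel (n k : ℤ) :
    ‖symbol n k‖ₑ ≤ 2 * (kernel n k * weight (9 / 4) k * weight (9 / 4) (n - k)) := by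
  by_cases h : n ∈ between k
  · refine enorm_symbol_le.trans ?_
    refine mul_le_mul_right ?_ 2
    have hk := (abs_le_of_mem_between h).2.2
    have h0 : weight (1 / 2) k ≠ 0 := (zero_lt_one.trans_le (one_le_weight (by norm_num) hk)).ne'
    rw [kernel, if_pos h, mul_assoc, mul_comm (weight (1 / 2) k)⁻¹]
    rw [← div_eq_mul_inv, ENNReal.le_div_iff_mul_le (Or.inl h0) (Or.inl (weight_ne_top _ _))]
    exact weight_le_of_mem_between h
  · simp [symbol_eq_zero h]

/-- At most `|k|` integers lie between `0` and `k`, and each contributes `|k|⁻¹`. -/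
theorem tsum_kernel_sq_le (k : ℤ) : ∑' n, kernel n k ^ 2 ≤ 1 := by
  by_cases hk : k = 0
  · subst hk; simp [kernel, between]
  have h0 : weight 1 k ≠ 0 := (zero_lt_one.trans_le (one_le_weight (by norm_num) hk)).ne'
  have : ∀ n, kernel n k ^ 2 = if n ∈ between k then (weight 1 k)⁻¹ else 0 := fun n => by
    unfold kernel; split_ifs
    · rw [← ENNReal.inv_pow, weight_sq (by norm_num)]; norm_num
    · simp
  simp only [this]
  rw [tsum_eq_sum (s := between k) (fun n hn => by simp [hn])]
  rw [Finset.sum_congr rfl (fun n hn => if_pos hn), Finset.sum_const, nsmul_eq_mul]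
  calc _ ≤ weight 1 k * (weight 1 k)⁻¹ := by gcongr; exact card_between_le
    _ = 1 := ENNReal.mul_inv_cancel h0 (weight_ne_top _ _)

theorem sobolevSum_eq_tsum_sq (c : ℤ → ℂ) :
    sobolevSum (9 / 2) c = ∑' n, (weight (9 / 4) n * ‖c n‖ₑ) ^ 2 := by
  unfold sobolevSum
  congr 1; ext n
  rw [mul_pow, weight_sq (by norm_num)]; norm_num

/-- For fixed `n`, Cauchy–Schwarz in `k` separates the factor in `n - k`, whose square sum is
independent of `n`. The sum over `n` then falls on the squared kernel alone. Absolute values are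
kept inside the sum so that the bound also yields convergence of the series. -/
theorem tsum_enorm_symbol_sq_le (c d : ℤ → ℂ) :
    ∑' n, (∑' k, ‖symbol n k * (c k * d (n - k))‖ₑ) ^ 2 ≤
      4 * (sobolevSum (9 / 2) c * sobolevSum (9 / 2) d) := by
  set a : ℤ → ℝ≥0∞ := fun k => weight (9 / 4) k * ‖c k‖ₑ with ha
  set b : ℤ → ℝ≥0∞ := fun k => weight (9 / 4) k * ‖d k‖ₑ with hb
  have h1 : ∀ n, (∑' k, ‖symbol n k * (c k * d (n - k))‖ₑ) ^ 2 ≤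
      4 * ((∑' k, kernel n k ^ 2 * a k ^ 2) * ∑' m, b m ^ 2) := fun n => by
    have : ∑' k, ‖symbol n k * (c k * d (n - k))‖ₑ ≤
        2 * ∑' k, (kernel n k * a k) * b (n - k) := by
      rw [← ENNReal.tsum_mul_left]
      refine ENNReal.tsum_le_tsum fun k => ?_
      rw [enorm_mul, enorm_mul]
      calc _ ≤ 2 * (kernel n k * weight (9 / 4) k * weight (9 / 4) (n - k)) *
            (‖c k‖ₑ * ‖d (n - k)‖ₑ) := by gcongr; exact enorm_symbol_le_kernel n k
        _ = _ := by simp only [ha, hb]; ring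
    calc _ ≤ (2 * ∑' k, (kernel n k * a k) * b (n - k)) ^ 2 := by gcongr
      _ = 4 * (∑' k, (kernel n k * a k) * b (n - k)) ^ 2 := by rw [mul_pow]; norm_num
      _ ≤ 4 * ((∑' k, (kernel n k * a k) ^ 2) * ∑' k, b (n - k) ^ 2) := by
          gcongr; exact sq_tsum_mul_le _ _
      _ = _ := by
          simp only [mul_pow]
          rw [tsum_sub_left (fun m => b m ^ 2)]
  calc _ ≤ ∑' n, 4 * ((∑' k, kernel n k ^ 2 * a k ^ 2) * ∑' m, b m ^ 2) :=
        ENNReal.tsum_le_tsum h1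
    _ = 4 * ((∑' k, (∑' n, kernel n k ^ 2) * a k ^ 2) * ∑' m, b m ^ 2) := by
        rw [ENNReal.tsum_mul_left, ENNReal.tsum_mul_right, ENNReal.tsum_comm]
        simp only [ENNReal.tsum_mul_right]
    _ ≤ 4 * ((∑' k, 1 * a k ^ 2) * ∑' m, b m ^ 2) := by
        gcongr with k; exact tsum_kernel_sq_le k
    _ = _ := by simp only [one_mul, sobolevSum_eq_tsum_sq, ha, hb]

theorem energy_bilinear_le (c d : ℤ → ℂ) :
    energy (bilinear c d) ≤ 4 * (sobolevSum (9 / 2) c * sobolevSum (9 / 2) d) := by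
  refine le_trans (ENNReal.tsum_le_tsum fun n => ?_) (tsum_enorm_symbol_sq_le c d)
  gcongr
  exact enorm_tsum_le_tsum_enorm

/-! ### Convergence of the bilinear series and its identification with the commutator -/

theorem summable_bilinear {c d : ℤ → ℂ} (hc : sobolevSum (9 / 2) c < ∞)
    (hd : sobolevSum (9 / 2) d < ∞) (n : ℤ) :
    Summable fun k => symbol n k * (c k * d (n - k)) := by
  have h := (tsum_enorm_symbol_sq_le c d).trans_lt
    (ENNReal.mul_lt_top (by norm_num) (ENNReal.mul_lt_top hc hd))
  have h2 := (ENNReal.le_tsum n).trans_lt h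
  have h3 : ∑' k, ‖symbol n k * (c k * d (n - k))‖ₑ ≠ ∞ := by
    intro h4; rw [h4] at h2; simp at h2
  exact Summable.of_enorm h3

theorem bilinear_sub {c d : ℤ → ℂ} (hc : sobolevSum (9 / 2) c < ∞)
    (hd : sobolevSum (9 / 2) d < ∞) (hcd : sobolevSum (9 / 2) (fun n => c n - d n) < ∞) (n : ℤ) :
    bilinear c c n - bilinear d d n =
      bilinear (fun n => c n - d n) c n + bilinear d (fun n => c n - d n) n := by
  unfold bilinear
  rw [← (summable_bilinear hc hc n).tsum_sub (summable_bilinear hd hd n),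
    ← (summable_bilinear hcd hc n).tsum_add (summable_bilinear hd hcd n)]
  congr 1; ext k; ring

/-- The convolution of `c` and `Λ³ d` converges absolutely. -/
theorem summable_mul_cube {c d : ℤ → ℂ} (hc0 : c 0 = 0) (hc : sobolevSum (9 / 2) c < ∞)
    (hd : sobolevSum (9 / 2) d < ∞) (n : ℤ) :
    Summable fun k => ‖c k‖ * (|((n - k : ℤ) : ℝ)| ^ 3 * ‖d (n - k)‖) := by
  have h := sq_tsum_mul_le (fun k => weight (9 / 4) k * ‖c k‖ₑ)
    (fun k => weight (9 / 4) (n - k) * ‖d (n - k)‖ₑ)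
  rw [tsum_sub_left (fun m => (weight (9 / 4) m * ‖d m‖ₑ) ^ 2),
    ← sobolevSum_eq_tsum_sq, ← sobolevSum_eq_tsum_sq] at h
  have h1 := h.trans_lt (ENNReal.mul_lt_top hc hd)
  have h3 : ∑' k, weight (9 / 4) k * ‖c k‖ₑ * (weight (9 / 4) (n - k) * ‖d (n - k)‖ₑ) ≠ ∞ := by
    intro h4; rw [h4] at h1; simp at h1
  have h5 : Summable fun k : ℤ => (|(k : ℝ)| ^ (9 / 4 : ℝ) * ‖c k‖) *
      (|((n - k : ℤ) : ℝ)| ^ (9 / 4 : ℝ) * ‖d (n - k)‖) := by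
    refine Summable.of_enorm ?_
    convert h3 using 4 with k
    rw [enorm_mul, enorm_mul, enorm_mul, enorm_norm, enorm_norm,
      Real.enorm_of_nonneg (by positivity), Real.enorm_of_nonneg (by positivity)]
    rfl
  refine Summable.of_nonneg_of_le (fun k => by positivity) (fun k => ?_)
    (h5.mul_left ((|(n : ℝ)| + 1) ^ (3 / 4 : ℝ)))
  by_cases hk : k = 0
  · subst hk; simp [hc0]
  have hk1 := one_le_abs_cast hk
  -- For fixed `n`, the frequency `|n - k|` is bounded by a multiple of `|k|`, so three quarters of
  -- a derivative can pass from `d` to `c` at the cost of a constant depending on `n`. No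
  -- cancellation is needed here.
  have e1 : |((n - k : ℤ) : ℝ)| ≤ (|(n : ℝ)| + 1) * |(k : ℝ)| := by
    push_cast
    calc _ ≤ |(n : ℝ)| + |(k : ℝ)| := abs_sub _ _
      _ ≤ _ := by nlinarith [abs_nonneg (n : ℝ)]
  have e2 : |((n - k : ℤ) : ℝ)| ^ 3 =
      |((n - k : ℤ) : ℝ)| ^ (3 / 4 : ℝ) * |((n - k : ℤ) : ℝ)| ^ (9 / 4 : ℝ) := by
    rw [← Real.rpow_add_of_nonneg (abs_nonneg _) (by norm_num) (by norm_num)]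
    norm_num
  have e3 : |((n - k : ℤ) : ℝ)| ^ (3 / 4 : ℝ) ≤
      (|(n : ℝ)| + 1) ^ (3 / 4 : ℝ) * |(k : ℝ)| ^ (9 / 4 : ℝ) := by
    calc _ ≤ ((|(n : ℝ)| + 1) * |(k : ℝ)|) ^ (3 / 4 : ℝ) := by gcongr
      _ = (|(n : ℝ)| + 1) ^ (3 / 4 : ℝ) * |(k : ℝ)| ^ (3 / 4 : ℝ) :=
          Real.mul_rpow (by positivity) (by positivity)
      _ ≤ _ := by
          gcongr
          norm_num
  rw [e2]
  calc _ = |((n - k : ℤ) : ℝ)| ^ (3 / 4 : ℝ) *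
        (‖c k‖ * (|((n - k : ℤ) : ℝ)| ^ (9 / 4 : ℝ) * ‖d (n - k)‖)) := by ring
    _ ≤ ((|(n : ℝ)| + 1) ^ (3 / 4 : ℝ) * |(k : ℝ)| ^ (9 / 4 : ℝ)) *
        (‖c k‖ * (|((n - k : ℤ) : ℝ)| ^ (9 / 4 : ℝ) * ‖d (n - k)‖)) := by gcongr
    _ = _ := by ring

/-- The two terms of the commutator are separate series. Merging them into one requires each to
converge without the cancellation, which is what `summable_mul_cube` supplies. -/
theorem nonlinearity_eq_bilinear {c : ℤ → ℂ} (hc0 : c 0 = 0) (hc : sobolevSum (9 / 2) c < ∞)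
    (n : ℤ) : nonlinearity c n = bilinear c c n := by
  have hs := summable_mul_cube hc0 hc hc n
  have h1 : Summable fun k => c k * calderonCube c (n - k) := by
    refine Summable.of_norm (hs.congr fun k => ?_)
    rw [calderonCube_apply, norm_mul, norm_mul, Complex.norm_real, Real.norm_of_nonneg (by positivity)]
  have h2 : Summable fun k => c k * hilbert (calderonCube c) (n - k) := by
    refine Summable.of_norm_bounded hs fun k => ?_
    rw [hilbert, calderonCube_apply, norm_mul, norm_mul, norm_mul, norm_mul, Complex.norm_real,
      Real.norm_of_nonneg (by positivity)]
    have : ‖-Complex.I‖ * ‖(((n - k).sign : ℤ) : ℂ)‖ ≤ 1 := by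
      rcases Int.sign_trichotomy (n - k) with h' | h' | h' <;> rw [h'] <;> simp
    refine mul_le_mul_of_nonneg_left ?_ (norm_nonneg _)
    calc _ ≤ 1 * (|((n - k : ℤ) : ℝ)| ^ 3 * ‖c (n - k)‖) := by gcongr
      _ = _ := one_mul _
  unfold nonlinearity ddx commHilbert bilinear
  rw [show hilbert (mul c (calderonCube c)) n =
    -Complex.I * (n.sign : ℂ) * mul c (calderonCube c) n from rfl]
  unfold mul
  rw [← tsum_mul_left, ← (h1.mul_left _).tsum_sub h2, ← tsum_mul_left]
  congr 1; ext k
  rw [hilbert, calderonCube_apply, symbol]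
  simp only [Int.cast_mul, Int.cast_pow, intCast_abs_eq, Int.cast_sub, Complex.ofReal_pow]
  have := Complex.I_mul_I
  linear_combination (-(n : ℂ) * ((n.sign : ℂ) - ((n - k).sign : ℂ)) * |(n : ℝ) - k| ^ 3 *
    c k * c (n - k)) * this

/-! ### Integration by parts against an exponential -/

/-- Since `g` is only integrable, integration by parts is done for absolutely continuous functions:
the primitive of `g` is one, with derivative `g` almost everywhere. -/
theorem integral_exp_mul_eq_sub_real (μ t : ℝ) {g : ℝ → ℝ} (hg : IntervalIntegrable g volume 0 t) :
    ∫ s in (0 : ℝ)..t, Real.exp (μ * s) * g s =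
      Real.exp (μ * t) * (∫ s in (0 : ℝ)..t, g s) -
        ∫ s in (0 : ℝ)..t, μ * Real.exp (μ * s) * ∫ r in (0 : ℝ)..s, g r := by
  have hd : ∀ s, HasDerivAt (fun s => Real.exp (μ * s)) (μ * Real.exp (μ * s)) s := fun s => by
    have := ((hasDerivAt_id s).const_mul μ).exp
    simpa [mul_comm] using this
  have hf : AbsolutelyContinuousOnInterval (fun s => Real.exp (μ * s)) 0 t :=
    ContDiffOn.absolutelyContinuousOnInterval (by fun_prop)
  have hG := hg.absolutelyContinuousOnInterval_intervalIntegral (c := 0) (by simp)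
  have h := hf.integral_mul_deriv_eq_deriv_mul hG
  simp only [intervalIntegral.integral_same, mul_zero, sub_zero, (hd _).deriv] at h
  rw [← h]
  refine intervalIntegral.integral_congr_ae ?_
  filter_upwards [hg.ae_hasDerivAt_integral] with s hs hs'
  rw [(hs (uIoc_subset_uIcc hs') 0 (by simp)).deriv]

theorem _root_.IntervalIntegrable.complex_ofReal {f : ℝ → ℝ} {a b : ℝ}
    (h : IntervalIntegrable f volume a b) :
    IntervalIntegrable (fun s => (f s : ℂ)) volume a b :=
  ⟨h.1.ofReal, h.2.ofReal⟩

theorem _root_.MeasureTheory.LocallyIntegrable.intervalIntegrable_real {f : ℝ → ℂ}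
    (h : LocallyIntegrable f volume) (a b : ℝ) : IntervalIntegrable f volume a b :=
  (h.integrableOn_isCompact isCompact_uIcc).intervalIntegrable

/-- The real case applied to real and imaginary parts. The constant `c` adds `0` in total, because
`∫₀ᵗ μ e^{μs} c ds = (e^{μt} - 1) c`; it stands for the initial datum. -/
theorem integral_exp_mul_eq_sub (μ t : ℝ) {g : ℝ → ℂ} (c : ℂ)
    (hg : ∀ a b, IntervalIntegrable g volume a b) :
    ∫ s in (0 : ℝ)..t, (Real.exp (μ * s) : ℂ) * g s =
      Real.exp (μ * t) * (c + ∫ s in (0 : ℝ)..t, g s) - c -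
        ∫ s in (0 : ℝ)..t, (μ : ℂ) * Real.exp (μ * s) * (c + ∫ r in (0 : ℝ)..s, g r) := by
  have hre : ∀ a b, IntervalIntegrable (fun s => (g s).re) volume a b := fun a b =>
    ⟨(hg a b).1.re, (hg a b).2.re⟩
  have him : ∀ a b, IntervalIntegrable (fun s => (g s).im) volume a b := fun a b =>
    ⟨(hg a b).1.im, (hg a b).2.im⟩
  have hexp : Continuous fun s : ℝ => Real.exp (μ * s) := by fun_prop
  have hG : ∀ s, ∫ r in (0 : ℝ)..s, g r =
      ((∫ r in (0 : ℝ)..s, (g r).re : ℝ) : ℂ) + ((∫ r in (0 : ℝ)..s, (g r).im : ℝ) : ℂ) * Complex.I := by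
    intro s
    rw [← intervalIntegral.integral_ofReal, ← intervalIntegral.integral_ofReal,
      ← intervalIntegral.integral_mul_const, ← intervalIntegral.integral_add]
    · simp only [Complex.re_add_im]
    · exact (hre 0 s).complex_ofReal
    · exact (him 0 s).complex_ofReal.mul_const _
  have hcexp : ∫ s in (0 : ℝ)..t, (μ : ℂ) * Real.exp (μ * s) * c =
      Real.exp (μ * t) * c - c := by
    have hd : ∀ s, HasDerivAt (fun s => Real.exp (μ * s)) (μ * Real.exp (μ * s)) s := fun s => by
      have := ((hasDerivAt_id s).const_mul μ).exp
      simpa [mul_comm] using this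
    have h : ∫ s in (0 : ℝ)..t, μ * Real.exp (μ * s) = Real.exp (μ * t) - Real.exp (μ * 0) :=
      intervalIntegral.integral_eq_sub_of_hasDerivAt (fun s _ => hd s)
        ((by fun_prop : Continuous fun s : ℝ => μ * Real.exp (μ * s)).intervalIntegrable _ _)
    rw [intervalIntegral.integral_mul_const]
    have h2 := congrArg (fun x : ℝ => (x : ℂ)) h
    simp only [← intervalIntegral.integral_ofReal, Complex.ofReal_mul, mul_zero, Real.exp_zero,
      Complex.ofReal_sub, Complex.ofReal_one] at h2
    rw [h2]; ring
  have hGc : Continuous fun s => ∫ r in (0 : ℝ)..s, g r := intervalIntegral.continuous_primitive hg 0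
  have hGre : Continuous fun s => ∫ r in (0 : ℝ)..s, (g r).re :=
    intervalIntegral.continuous_primitive hre 0
  have hGim : Continuous fun s => ∫ r in (0 : ℝ)..s, (g r).im :=
    intervalIntegral.continuous_primitive him 0
  have hmain : ∫ s in (0 : ℝ)..t, (Real.exp (μ * s) : ℂ) * g s =
      Real.exp (μ * t) * (∫ s in (0 : ℝ)..t, g s) -
        ∫ s in (0 : ℝ)..t, (μ : ℂ) * Real.exp (μ * s) * ∫ r in (0 : ℝ)..s, g r := by
    have e1 : ∫ s in (0 : ℝ)..t, (Real.exp (μ * s) : ℂ) * g s =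
        ((∫ s in (0 : ℝ)..t, Real.exp (μ * s) * (g s).re : ℝ) : ℂ) +
        ((∫ s in (0 : ℝ)..t, Real.exp (μ * s) * (g s).im : ℝ) : ℂ) * Complex.I := by
      rw [← intervalIntegral.integral_ofReal, ← intervalIntegral.integral_ofReal,
        ← intervalIntegral.integral_mul_const, ← intervalIntegral.integral_add]
      · congr 1; ext s
        conv_lhs => rw [← Complex.re_add_im (g s)]
        push_cast; ring
      · exact ((hre 0 t).continuousOn_mul hexp.continuousOn).complex_ofReal
      · exact ((him 0 t).continuousOn_mul hexp.continuousOn).complex_ofReal.mul_const _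
    have e2 : ∫ s in (0 : ℝ)..t, (μ : ℂ) * Real.exp (μ * s) * ∫ r in (0 : ℝ)..s, g r =
        ((∫ s in (0 : ℝ)..t, μ * Real.exp (μ * s) * ∫ r in (0 : ℝ)..s, (g r).re : ℝ) : ℂ) +
        ((∫ s in (0 : ℝ)..t, μ * Real.exp (μ * s) * ∫ r in (0 : ℝ)..s, (g r).im : ℝ) : ℂ) *
          Complex.I := by
      rw [← intervalIntegral.integral_ofReal, ← intervalIntegral.integral_ofReal,
        ← intervalIntegral.integral_mul_const, ← intervalIntegral.integral_add]
      · congr 1; ext s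
        rw [hG s]
        push_cast; ring
      · exact Continuous.intervalIntegrable (by fun_prop) _ _
      · exact Continuous.intervalIntegrable (by fun_prop) _ _
    rw [e1, e2, hG t, integral_exp_mul_eq_sub_real μ t (hre 0 t),
      integral_exp_mul_eq_sub_real μ t (him 0 t)]
    push_cast; ring
  have hsplit : ∫ s in (0 : ℝ)..t, (μ : ℂ) * Real.exp (μ * s) * (c + ∫ r in (0 : ℝ)..s, g r) =
      (∫ s in (0 : ℝ)..t, (μ : ℂ) * Real.exp (μ * s) * c) +
      ∫ s in (0 : ℝ)..t, (μ : ℂ) * Real.exp (μ * s) * ∫ r in (0 : ℝ)..s, g r := by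
    rw [← intervalIntegral.integral_add]
    · congr 1; ext s; ring
    · exact Continuous.intervalIntegrable (by fun_prop) _ _
    · exact Continuous.intervalIntegrable (by fun_prop) _ _
  rw [hmain, hsplit, hcexp]; ring

/-! ### Duhamel's formula -/

/-- The decay rate `|n|³` of the `n`-th mode. -/
def rate (n : ℤ) : ℝ := |(n : ℝ)| ^ 3

theorem rate_nonneg (n : ℤ) : 0 ≤ rate n := by unfold rate; positivity

theorem weight_three_eq (n : ℤ) : weight 3 n = ENNReal.ofReal (rate n) := weight_three n

/-- The solution of the linear equation with datum `c` and no forcing. -/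
def free (c : ℤ → ℂ) (t : ℝ) (n : ℤ) : ℂ := (Real.exp (-(rate n) * t) : ℂ) * c n

/-- The solution of the linear equation with zero datum and forcing `F`. -/
def forced (F : ℝ → ℤ → ℂ) (t : ℝ) (n : ℤ) : ℂ :=
  (Real.exp (-(rate n) * t) : ℂ) * ∫ τ in (0 : ℝ)..t, (Real.exp (rate n * τ) : ℂ) * F τ n

/-- The solution of the linear equation with datum `c` and forcing `F`. -/
def duhamel (c : ℤ → ℂ) (F : ℝ → ℤ → ℂ) (t : ℝ) (n : ℤ) : ℂ := free c t n + forced F t n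

/-- Space-time square-integrable forcings. -/
structure IsForcing (F : ℝ → ℤ → ℂ) : Prop where
  meas : ∀ n, AEStronglyMeasurable (fun t => F t n) volume
  fin : ∫⁻ t, energy (F t) < ∞

theorem enorm_sq_le_energy (c : ℤ → ℂ) (n : ℤ) : ‖c n‖ₑ ^ 2 ≤ energy c :=
  ENNReal.le_tsum (f := fun n => ‖c n‖ₑ ^ 2) n

theorem IsForcing.memLp {F : ℝ → ℤ → ℂ} (hF : IsForcing F) (n : ℤ) :
    MemLp (fun t => F t n) 2 volume := by
  refine ⟨hF.meas n, ?_⟩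
  rw [eLpNorm_lt_top_iff_lintegral_rpow_enorm_lt_top (by norm_num) (by norm_num)]
  refine lt_of_le_of_lt (lintegral_mono fun t => ?_) hF.fin
  simpa using enorm_sq_le_energy (F t) n

theorem IsForcing.intervalIntegrable {F : ℝ → ℤ → ℂ} (hF : IsForcing F) (n : ℤ) (a b : ℝ) :
    IntervalIntegrable (fun t => F t n) volume a b := by
  have : LocallyIntegrable (fun t => F t n) volume := (hF.memLp n).locallyIntegrable (by norm_num)
  exact this.intervalIntegrable_real a b

theorem IsForcing.intervalIntegrable_exp_mul {F : ℝ → ℤ → ℂ} (hF : IsForcing F) (n : ℤ)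
    (μ a b : ℝ) : IntervalIntegrable (fun t => (Real.exp (μ * t) : ℂ) * F t n) volume a b :=
  (hF.intervalIntegrable n a b).continuousOn_mul (by fun_prop)

theorem IsForcing.sub {F G : ℝ → ℤ → ℂ} (hF : IsForcing F) (hG : IsForcing G) :
    IsForcing (fun t n => F t n - G t n) := by
  refine ⟨fun n => (hF.meas n).sub (hG.meas n), ?_⟩
  have : ∀ t, energy (fun n => F t n - G t n) ≤ 2 * (energy (F t) + energy (G t)) := fun t => by
    have := energy_add_le (F t) (fun n => -G t n)
    simpa [sub_eq_add_neg, energy] using this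
  have hm : AEMeasurable (fun t => energy (F t)) volume :=
    AEMeasurable.tsum fun n => (hF.meas n).enorm.pow_const 2
  calc _ ≤ ∫⁻ t, 2 * (energy (F t) + energy (G t)) := lintegral_mono this
    _ = 2 * ((∫⁻ t, energy (F t)) + ∫⁻ t, energy (G t)) := by
        rw [lintegral_const_mul' _ _ (by norm_num), lintegral_add_left' hm]
    _ < ∞ := ENNReal.mul_lt_top (by norm_num) (ENNReal.add_lt_top.2 ⟨hF.fin, hG.fin⟩)

theorem duhamel_zero (c : ℤ → ℂ) (F : ℝ → ℤ → ℂ) (n : ℤ) : duhamel c F 0 n = c n := by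
  simp [duhamel, free, forced]

theorem duhamel_sub (c : ℤ → ℂ) {F G : ℝ → ℤ → ℂ} (hF : IsForcing F) (hG : IsForcing G)
    (t : ℝ) (n : ℤ) :
    duhamel c F t n - duhamel c G t n = forced (fun t n => F t n - G t n) t n := by
  simp only [duhamel, forced]
  rw [add_sub_add_left_eq_sub, ← mul_sub, ← intervalIntegral.integral_sub
    (hF.intervalIntegrable_exp_mul n _ _ _) (hG.intervalIntegrable_exp_mul n _ _ _)]
  simp only [mul_sub]

theorem IsForcing.continuous_duhamel (c : ℤ → ℂ) {F : ℝ → ℤ → ℂ} (hF : IsForcing F) (n : ℤ) :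
    Continuous fun t => duhamel c F t n := by
  have := intervalIntegral.continuous_primitive
    (fun a b => hF.intervalIntegrable_exp_mul n (rate n) a b) 0
  unfold duhamel free forced
  fun_prop

/-- Duhamel's formula solves the equation integrated in time. -/
theorem IsForcing.duhamel_eq_integral (c : ℤ → ℂ) {F : ℝ → ℤ → ℂ} (hF : IsForcing F)
    (t : ℝ) (n : ℤ) :
    duhamel c F t n =
      c n + ∫ τ in (0 : ℝ)..t, (-((rate n : ℂ) * duhamel c F τ n) + F τ n) := by
  -- The function integrated by parts is `e^{|n|³τ} F`, against `e^{-|n|³τ}`: the left side becomes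
  -- `∫ F`, and the right side contains Duhamel's formula.
  have h := integral_exp_mul_eq_sub (-rate n) t (c n)
    (fun a b => hF.intervalIntegrable_exp_mul n (rate n) a b)
  have e1 : ∀ s : ℝ, (Real.exp (-rate n * s) : ℂ) * ((Real.exp (rate n * s) : ℂ) * F s n) = F s n :=
    fun s => by
      rw [← mul_assoc, ← Complex.ofReal_mul, ← Real.exp_add]; simp
  have e2 : ∀ s : ℝ, ((-rate n : ℝ) : ℂ) * (Real.exp (-rate n * s) : ℂ) *
      (c n + ∫ r in (0 : ℝ)..s, (Real.exp (rate n * r) : ℂ) * F r n) =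
      -((rate n : ℂ) * duhamel c F s n) := fun s => by
    unfold duhamel free forced; push_cast; ring
  simp only [e1, e2] at h
  rw [intervalIntegral.integral_add _ (hF.intervalIntegrable n _ _), h]
  · unfold duhamel free forced; push_cast; ring
  · have := hF.continuous_duhamel c n
    exact Continuous.intervalIntegrable (by fun_prop) _ _

/-- A solution of the equation integrated in time is given by Duhamel's formula. -/
theorem eq_duhamel_of_eq_integral (c : ℤ → ℂ) {F : ℝ → ℤ → ℂ} (hF : IsForcing F) {n : ℤ}
    {I : Set ℝ} (hI : ∀ t ∈ I, 0 ≤ t ∧ Icc 0 t ⊆ I) {v : ℝ → ℂ}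
    (hv : LocallyIntegrable (I.indicator v) volume)
    (h : ∀ᵐ t ∂volume, t ∈ I →
      v t = c n + ∫ τ in (0 : ℝ)..t, (-((rate n : ℂ) * v τ) + F τ n)) :
    ∀ᵐ t ∂volume, t ∈ I → v t = duhamel c F t n := by
  -- Extending `v` by zero outside `I` makes the integrand integrable on every interval without
  -- changing the integrals up to times in `I`.
  set g : ℝ → ℂ := fun τ => -((rate n : ℂ) * I.indicator v τ) + F τ n with hg
  have hgi : ∀ a b, IntervalIntegrable g volume a b := fun a b =>
    ((hv.intervalIntegrable_real a b).const_mul _).neg.add (hF.intervalIntegrable n a b)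
  have hcongr : ∀ t ∈ I, ∫ τ in (0 : ℝ)..t, (-((rate n : ℂ) * v τ) + F τ n) =
      ∫ τ in (0 : ℝ)..t, g τ := fun t ht => by
    refine intervalIntegral.integral_congr fun τ hτ => ?_
    rw [uIcc_of_le (hI t ht).1] at hτ
    simp only [hg, indicator_of_mem ((hI t ht).2 hτ)]
  filter_upwards [h] with t hvt ht
  have hvt := (hvt ht).trans (by rw [hcongr t ht])
  -- The integrating factor: `c + ∫ g` is `v` itself almost everywhere, so the terms in `|n|³ v`
  -- cancel and `∫ e^{|n|³s} F` remains.
  have key := integral_exp_mul_eq_sub (rate n) t (c n) hgi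
  have e1 : ∫ s in (0 : ℝ)..t, (rate n : ℂ) * Real.exp (rate n * s) *
      (c n + ∫ r in (0 : ℝ)..s, g r) =
      ∫ s in (0 : ℝ)..t, (Real.exp (rate n * s) : ℂ) * (-(g s - F s n)) := by
    refine intervalIntegral.integral_congr_ae ?_
    filter_upwards [h] with s hs hs'
    rw [uIoc_of_le (hI t ht).1] at hs'
    have hsI : s ∈ I := (hI t ht).2 ⟨hs'.1.le, hs'.2⟩
    rw [← hcongr s hsI, ← hs hsI]
    simp only [hg, indicator_of_mem hsI]
    ring
  have e2 : ∫ s in (0 : ℝ)..t, (Real.exp (rate n * s) : ℂ) * (-(g s - F s n)) =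
      (∫ s in (0 : ℝ)..t, (Real.exp (rate n * s) : ℂ) * F s n) -
      ∫ s in (0 : ℝ)..t, (Real.exp (rate n * s) : ℂ) * g s := by
    rw [← intervalIntegral.integral_sub (hF.intervalIntegrable_exp_mul n _ _ _)
      ((hgi _ _).continuousOn_mul (by fun_prop))]
    congr 1; ext s; ring
  rw [e1, e2, ← hvt] at key
  have key2 : ∫ s in (0 : ℝ)..t, (Real.exp (rate n * s) : ℂ) * F s n =
      Real.exp (rate n * t) * v t - c n := by linear_combination key
  unfold duhamel free forced
  rw [key2, mul_sub, ← mul_assoc, ← Complex.ofReal_mul, ← Real.exp_add]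
  simp

/-! ### Parabolic smoothing -/

/-- Measurable sets of times which contain `[0, t]` together with `t`. -/
structure IsTimeSet (I : Set ℝ) : Prop where
  measurableSet : MeasurableSet I
  nonneg : ∀ t ∈ I, 0 ≤ t
  Icc_subset : ∀ t ∈ I, Icc 0 t ⊆ I

theorem isTimeSet_timeInterval (T : ℝ≥0∞) : IsTimeSet (timeInterval T) where
  measurableSet := by
    refine MeasurableSet.inter measurableSet_Ici ?_
    exact measurableSet_le ENNReal.measurable_ofReal measurable_const
  nonneg _ ht := ht.1
  Icc_subset _ ht s hs := ⟨hs.1, (ENNReal.ofReal_le_ofReal hs.2).trans ht.2⟩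

theorem isTimeSet_Icc (b : ℝ) : IsTimeSet (Icc 0 b) where
  measurableSet := measurableSet_Icc
  nonneg _ ht := ht.1
  Icc_subset _ ht := Icc_subset_Icc_right ht.2

/-- The kernel `e^{-|n|³ x}`, restricted to `x ≥ 0`. -/
def heatKernel (n : ℤ) (x : ℝ) : ℝ≥0∞ :=
  ENNReal.ofReal (if 0 ≤ x then Real.exp (-(rate n * x)) else 0)

theorem measurable_heatKernel (n : ℤ) : Measurable (heatKernel n) :=
  (Measurable.ite measurableSet_Ici (by fun_prop) measurable_const).ennreal_ofReal

theorem heatKernel_le_one (n : ℤ) (x : ℝ) : heatKernel n x ≤ 1 := by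
  unfold heatKernel
  rw [ENNReal.ofReal_le_one]
  split_ifs with hx
  · exact Real.exp_le_one_iff.2 (neg_nonpos.2 (mul_nonneg (rate_nonneg n) hx))
  · norm_num

/-- For `n ≠ 0` the product is the total mass of an exponential density of rate `|n|³`. -/
theorem weight_mul_lintegral_heatKernel_le (n : ℤ) : weight 3 n * ∫⁻ x, heatKernel n x ≤ 1 := by
  by_cases hn : n = 0
  · subst hn; rw [weight_zero_right (by norm_num)]; simp
  have hpos : 0 < rate n := by
    have := one_le_abs_cast hn
    unfold rate; positivity
  rw [← lintegral_const_mul _ (measurable_heatKernel n),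
    ← ProbabilityTheory.lintegral_exponentialPDF_eq_one hpos]
  refine lintegral_mono fun x => le_of_eq ?_
  rw [ProbabilityTheory.exponentialPDF_eq, weight_three_eq, heatKernel,
    ← ENNReal.ofReal_mul hpos.le]
  congr 1; split_ifs <;> simp

theorem enorm_forced_le {I : Set ℝ} (hI : IsTimeSet I) (F : ℝ → ℤ → ℂ) {t : ℝ} (ht : t ∈ I) (n : ℤ) :
    ‖forced F t n‖ₑ ≤ ∫⁻ τ in I, heatKernel n (t - τ) * ‖F τ n‖ₑ := by
  unfold forced
  rw [← intervalIntegral.integral_const_mul, intervalIntegral.integral_of_le (hI.nonneg t ht)]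
  refine (enorm_integral_le_lintegral_enorm _).trans ?_
  calc _ = ∫⁻ τ in Ioc 0 t, heatKernel n (t - τ) * ‖F τ n‖ₑ := by
        refine setLIntegral_congr_fun measurableSet_Ioc fun τ hτ => ?_
        rw [← mul_assoc, ← Complex.ofReal_mul, ← Real.exp_add, enorm_mul, heatKernel,
          if_pos (by linarith [hτ.2]), ← ofReal_norm, Complex.norm_real,
          Real.norm_of_nonneg (Real.exp_pos _).le]
        congr 3; ring
    _ ≤ _ := lintegral_mono_set (Ioc_subset_Icc_self.trans (hI.Icc_subset t ht))

/-- Cauchy–Schwarz after splitting the kernel into two square roots; the weight absorbs the mass of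
one copy. The other copy is kept: bounded by `1` it gives the estimate uniform in time, and
integrated in `t` it gains another `|n|³`. -/
theorem weight_mul_forced_sq_le {I : Set ℝ} (hI : IsTimeSet I) {F : ℝ → ℤ → ℂ}
    (hF : IsForcing F) {t : ℝ} (ht : t ∈ I) (n : ℤ) :
    weight 3 n * ‖forced F t n‖ₑ ^ 2 ≤ ∫⁻ τ in I, heatKernel n (t - τ) * ‖F τ n‖ₑ ^ 2 := by
  have hK : Measurable fun τ => heatKernel n (t - τ) :=
    (measurable_heatKernel n).comp (measurable_const.sub measurable_id)
  have hsq : ∀ τ, heatKernel n (t - τ) ^ (1 / 2 : ℝ) * heatKernel n (t - τ) ^ (1 / 2 : ℝ) =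
      heatKernel n (t - τ) := fun τ => by
    rw [← ENNReal.rpow_add_of_nonneg _ _ (by norm_num) (by norm_num)]; norm_num
  have h := sq_lintegral_mul_le (volume.restrict I)
    (f := fun τ => heatKernel n (t - τ) ^ (1 / 2 : ℝ))
    (g := fun τ => heatKernel n (t - τ) ^ (1 / 2 : ℝ) * ‖F τ n‖ₑ)
    (hK.pow_const _).aemeasurable
    ((hK.pow_const _).aemeasurable.mul (hF.meas n).restrict.enorm)
  simp only [mul_pow, ← mul_assoc, hsq] at h
  simp only [sq (heatKernel n _ ^ (1 / 2 : ℝ)), hsq] at h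
  calc _ ≤ weight 3 n * ((∫⁻ τ in I, heatKernel n (t - τ)) *
        ∫⁻ τ in I, heatKernel n (t - τ) * ‖F τ n‖ₑ ^ 2) := by
        gcongr
        refine le_trans ?_ h
        gcongr
        exact enorm_forced_le hI F ht n
    _ ≤ (weight 3 n * ∫⁻ τ, heatKernel n (t - τ)) *
        ∫⁻ τ in I, heatKernel n (t - τ) * ‖F τ n‖ₑ ^ 2 := by
        rw [← mul_assoc]
        gcongr
        exact Measure.restrict_le_self
    _ ≤ 1 * ∫⁻ τ in I, heatKernel n (t - τ) * ‖F τ n‖ₑ ^ 2 := by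
        gcongr
        rw [lintegral_sub_left_eq_self (heatKernel n) t]
        exact weight_mul_lintegral_heatKernel_le n
    _ = _ := one_mul _

theorem IsForcing.aemeasurable_energy {F : ℝ → ℤ → ℂ} (hF : IsForcing F) :
    AEMeasurable (fun t => energy (F t)) volume :=
  AEMeasurable.tsum fun n => (hF.meas n).enorm.pow_const 2

theorem IsForcing.lintegral_energy {F : ℝ → ℤ → ℂ} (hF : IsForcing F) (I : Set ℝ) :
    ∫⁻ t in I, energy (F t) = ∑' n, ∫⁻ t in I, ‖F t n‖ₑ ^ 2 :=
  lintegral_tsum fun n => (hF.meas n).restrict.enorm.pow_const 2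

theorem sobolevSum_three_forced_le {I : Set ℝ} (hI : IsTimeSet I) {F : ℝ → ℤ → ℂ}
    (hF : IsForcing F) {t : ℝ} (ht : t ∈ I) :
    sobolevSum 3 (forced F t) ≤ ∫⁻ τ in I, energy (F τ) := by
  rw [hF.lintegral_energy]
  refine ENNReal.tsum_le_tsum fun n => (weight_mul_forced_sq_le hI hF ht n).trans ?_
  refine lintegral_mono fun τ => ?_
  calc _ ≤ 1 * ‖F τ n‖ₑ ^ 2 := by gcongr; exact heatKernel_le_one _ _
    _ = _ := one_mul _

theorem IsForcing.continuous_forced {F : ℝ → ℤ → ℂ} (hF : IsForcing F) (n : ℤ) :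
    Continuous fun t => forced F t n := by
  have := intervalIntegral.continuous_primitive
    (fun a b => hF.intervalIntegrable_exp_mul n (rate n) a b) 0
  unfold forced
  fun_prop

theorem continuous_free (c : ℤ → ℂ) (n : ℤ) : Continuous fun t => free c t n := by
  unfold free; fun_prop

theorem measurable_sobolevSum (r : ℝ) {u : ℝ → ℤ → ℂ} (hu : ∀ n, Continuous fun t => u t n) :
    Measurable fun t => sobolevSum r (u t) :=
  Measurable.tsum fun n => ((hu n).measurable.enorm.pow_const 2).const_mul _

theorem lintegral_sobolevSum (r : ℝ) {u : ℝ → ℤ → ℂ} (hu : ∀ n, Continuous fun t => u t n)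
    (I : Set ℝ) :
    ∫⁻ t in I, sobolevSum r (u t) = ∑' n, ∫⁻ t in I, weight r n * ‖u t n‖ₑ ^ 2 :=
  lintegral_tsum fun n => (((hu n).measurable.enorm.pow_const 2).const_mul _).aemeasurable

/-- Of the weight `|n|⁶`, one half is used in the pointwise bound and the other, after Tonelli,
absorbs the time integral of the remaining kernel. -/
theorem lintegral_sobolevSum_six_forced_le {I : Set ℝ} (hI : IsTimeSet I) {F : ℝ → ℤ → ℂ}
    (hF : IsForcing F) : ∫⁻ t in I, sobolevSum 6 (forced F t) ≤ ∫⁻ t in I, energy (F t) := by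
  rw [hF.lintegral_energy, lintegral_sobolevSum 6 (fun n => hF.continuous_forced n)]
  refine ENNReal.tsum_le_tsum fun n => ?_
  have hm : AEMeasurable (Function.uncurry fun t τ => heatKernel n (t - τ) * ‖F τ n‖ₑ ^ 2)
      ((volume.restrict I).prod (volume.restrict I)) := by
    have h1 : Measurable fun p : ℝ × ℝ => heatKernel n (p.1 - p.2) :=
      (measurable_heatKernel n).comp (measurable_fst.sub measurable_snd)
    have h2 : AEMeasurable (fun p : ℝ × ℝ => ‖F p.2 n‖ₑ ^ 2)
        ((volume.restrict I).prod (volume.restrict I)) :=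
      (hF.meas n).restrict.comp_snd.enorm.pow_const 2
    exact h1.aemeasurable.mul h2
  calc ∫⁻ t in I, weight 6 n * ‖forced F t n‖ₑ ^ 2
      ≤ ∫⁻ t in I, weight 3 n * ∫⁻ τ in I, heatKernel n (t - τ) * ‖F τ n‖ₑ ^ 2 := by
        refine setLIntegral_mono' hI.measurableSet fun t ht => ?_
        rw [show (6 : ℝ) = 3 + 3 by norm_num, ← weight_mul (by norm_num) (by norm_num), mul_assoc]
        gcongr
        exact weight_mul_forced_sq_le hI hF ht n
    _ = weight 3 n * ∫⁻ τ in I, ∫⁻ t in I, heatKernel n (t - τ) * ‖F τ n‖ₑ ^ 2 := by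
        rw [lintegral_const_mul' _ _ (weight_ne_top _ _), lintegral_lintegral_swap hm]
    _ = ∫⁻ τ in I, (weight 3 n * ∫⁻ t in I, heatKernel n (t - τ)) * ‖F τ n‖ₑ ^ 2 := by
        rw [← lintegral_const_mul' _ _ (weight_ne_top _ _)]
        refine lintegral_congr fun τ => ?_
        rw [lintegral_mul_const' _ _ (by finiteness), mul_assoc]
    _ ≤ ∫⁻ τ in I, 1 * ‖F τ n‖ₑ ^ 2 := by
        gcongr with τ
        calc _ ≤ weight 3 n * ∫⁻ t, heatKernel n (t - τ) := by
              gcongr; exact Measure.restrict_le_self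
          _ ≤ 1 := by
              rw [lintegral_sub_right_eq_self (heatKernel n) τ]
              exact weight_mul_lintegral_heatKernel_le n
    _ = _ := by simp only [one_mul]

/-! ### Smoothing of the free evolution and the norm of `L⁴Ḣ^{9/4}` -/

theorem enorm_free (c : ℤ → ℂ) {t : ℝ} (ht : 0 ≤ t) (n : ℤ) :
    ‖free c t n‖ₑ = heatKernel n t * ‖c n‖ₑ := by
  rw [free, enorm_mul, heatKernel, if_pos ht, ← ofReal_norm, Complex.norm_real,
    Real.norm_of_nonneg (Real.exp_pos _).le, neg_mul]

theorem enorm_free_sq_le (c : ℤ → ℂ) {t : ℝ} (ht : 0 ≤ t) (n : ℤ) :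
    ‖free c t n‖ₑ ^ 2 ≤ heatKernel n t * ‖c n‖ₑ ^ 2 := by
  rw [enorm_free c ht, mul_pow]
  gcongr
  calc heatKernel n t ^ 2 = heatKernel n t * heatKernel n t := sq _
    _ ≤ heatKernel n t * 1 := by gcongr; exact heatKernel_le_one _ _
    _ = _ := mul_one _

theorem sobolevSum_free_le (r : ℝ) (c : ℤ → ℂ) {t : ℝ} (ht : 0 ≤ t) :
    sobolevSum r (free c t) ≤ sobolevSum r c := by
  refine ENNReal.tsum_le_tsum fun n => mul_le_mul_right ?_ _
  calc _ ≤ heatKernel n t * ‖c n‖ₑ ^ 2 := enorm_free_sq_le c ht n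
    _ ≤ 1 * ‖c n‖ₑ ^ 2 := by gcongr; exact heatKernel_le_one _ _
    _ = _ := one_mul _

theorem lintegral_sobolevSum_six_free_le {I : Set ℝ} (hI : IsTimeSet I) (c : ℤ → ℂ) :
    ∫⁻ t in I, sobolevSum 6 (free c t) ≤ sobolevSum 3 c := by
  rw [lintegral_sobolevSum 6 (fun n => continuous_free c n)]
  refine ENNReal.tsum_le_tsum fun n => ?_
  calc ∫⁻ t in I, weight 6 n * ‖free c t n‖ₑ ^ 2
      ≤ ∫⁻ t in I, (weight 3 n * ‖c n‖ₑ ^ 2) * (weight 3 n * heatKernel n t) := by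
        refine setLIntegral_mono' hI.measurableSet fun t ht => ?_
        rw [show (6 : ℝ) = 3 + 3 by norm_num, ← weight_mul (by norm_num) (by norm_num)]
        calc _ ≤ weight 3 n * weight 3 n * (heatKernel n t * ‖c n‖ₑ ^ 2) := by
              gcongr; exact enorm_free_sq_le c (hI.nonneg t ht) n
          _ = _ := by ring
    _ ≤ (weight 3 n * ‖c n‖ₑ ^ 2) * (weight 3 n * ∫⁻ t, heatKernel n t) := by
        rw [lintegral_const_mul' _ _ (ENNReal.mul_ne_top (weight_ne_top _ _) (by finiteness)),
          lintegral_const_mul' _ _ (weight_ne_top _ _)]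
        gcongr
        exact Measure.restrict_le_self
    _ ≤ (weight 3 n * ‖c n‖ₑ ^ 2) * 1 := by
        gcongr; exact weight_mul_lintegral_heatKernel_le n
    _ = _ := mul_one _

/-- The fourth power of the norm of `L⁴(I; Ḣ^{9/4})`. -/
def quarticNorm (I : Set ℝ) (u : ℝ → ℤ → ℂ) : ℝ≥0∞ := ∫⁻ t in I, sobolevSum (9 / 2) (u t) ^ 2

theorem quarticNorm_le_sq {I : Set ℝ} (hI : IsTimeSet I) {u : ℝ → ℤ → ℂ} {A : ℝ≥0∞}
    (hu : ∀ n, Continuous fun t => u t n)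
    (h3 : ∀ t ∈ I, sobolevSum 3 (u t) ≤ A) (h6 : ∫⁻ t in I, sobolevSum 6 (u t) ≤ A) :
    quarticNorm I u ≤ A ^ 2 :=
  calc quarticNorm I u ≤ ∫⁻ t in I, A * sobolevSum 6 (u t) := by
        refine setLIntegral_mono' hI.measurableSet fun t ht => ?_
        refine (sobolevSum_interpolation _).trans ?_
        gcongr; exact h3 t ht
    _ = A * ∫⁻ t in I, sobolevSum 6 (u t) := lintegral_const_mul _ (measurable_sobolevSum 6 hu)
    _ ≤ A ^ 2 := by rw [sq]; gcongr

theorem quarticNorm_forced_le {I : Set ℝ} (hI : IsTimeSet I) {F : ℝ → ℤ → ℂ}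
    (hF : IsForcing F) : quarticNorm I (forced F) ≤ (∫⁻ t in I, energy (F t)) ^ 2 :=
  quarticNorm_le_sq hI hF.continuous_forced (fun _ ht => sobolevSum_three_forced_le hI hF ht)
    (lintegral_sobolevSum_six_forced_le hI hF)

theorem quarticNorm_free_le {I : Set ℝ} (hI : IsTimeSet I) (c : ℤ → ℂ) :
    quarticNorm I (free c) ≤ sobolevSum 3 c ^ 2 :=
  quarticNorm_le_sq hI (continuous_free c) (fun t ht => sobolevSum_free_le 3 c (hI.nonneg t ht))
    (lintegral_sobolevSum_six_free_le hI c)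

theorem quarticNorm_duhamel_le {I : Set ℝ} (c : ℤ → ℂ) (F : ℝ → ℤ → ℂ) :
    quarticNorm I (duhamel c F) ≤ 8 * (quarticNorm I (free c) + quarticNorm I (forced F)) := by
  unfold quarticNorm
  have hm : Measurable fun t => sobolevSum (9 / 2) (free c t) ^ 2 :=
    (measurable_sobolevSum _ (continuous_free c)).pow_const 2
  rw [← lintegral_add_left hm, ← lintegral_const_mul' _ _ (by norm_num)]
  refine lintegral_mono fun t => ?_
  calc _ ≤ (2 * (sobolevSum (9 / 2) (free c t) + sobolevSum (9 / 2) (forced F t))) ^ 2 := by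
        gcongr; exact sobolevSum_add_le _ _ _
    _ ≤ 4 * (2 * (sobolevSum (9 / 2) (free c t) ^ 2 + sobolevSum (9 / 2) (forced F t) ^ 2)) := by
        rw [mul_pow]
        norm_num only
        gcongr; exact add_sq_le_two_mul _ _
    _ = _ := by ring

/-- The square of the bilinear estimate `L⁴ Ḣ^{9/4} × L⁴ Ḣ^{9/4} → L² L²`. -/
theorem sq_lintegral_energy_bilinear_le {I : Set ℝ} {u v : ℝ → ℤ → ℂ}
    (hu : AEMeasurable (fun t => sobolevSum (9 / 2) (u t)) (volume.restrict I))
    (hv : AEMeasurable (fun t => sobolevSum (9 / 2) (v t)) (volume.restrict I)) :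
    (∫⁻ t in I, energy (bilinear (u t) (v t))) ^ 2 ≤ 16 * (quarticNorm I u * quarticNorm I v) :=
  calc _ ≤ (∫⁻ t in I, 4 * (sobolevSum (9 / 2) (u t) * sobolevSum (9 / 2) (v t))) ^ 2 := by
        gcongr with t; exact energy_bilinear_le _ _
    _ = 16 * (∫⁻ t in I, sobolevSum (9 / 2) (u t) * sobolevSum (9 / 2) (v t)) ^ 2 := by
        rw [lintegral_const_mul' _ _ (by norm_num), mul_pow]; norm_num
    _ ≤ _ := by gcongr; exact sq_lintegral_mul_le _ hu hv

/-! ### The nonlinear forcing -/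

/-- `L⁴(I; Ḣ^{9/4})`, in terms of Fourier coefficients. -/
structure IsQuartic (I : Set ℝ) (u : ℝ → ℤ → ℂ) : Prop where
  meas : ∀ n, AEStronglyMeasurable (fun t => u t n) (volume.restrict I)
  fin : quarticNorm I u < ∞

theorem aemeasurable_sobolevSum (r : ℝ) {μ : Measure ℝ} {u : ℝ → ℤ → ℂ}
    (hu : ∀ n, AEStronglyMeasurable (fun t => u t n) μ) :
    AEMeasurable (fun t => sobolevSum r (u t)) μ :=
  AEMeasurable.tsum fun n => ((hu n).enorm.pow_const 2).const_mul _

theorem IsQuartic.ae_lt_top {I : Set ℝ} {u : ℝ → ℤ → ℂ} (hu : IsQuartic I u) :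
    ∀ᵐ t ∂(volume.restrict I), sobolevSum (9 / 2) (u t) < ∞ := by
  have := ae_lt_top' ((aemeasurable_sobolevSum (9 / 2) hu.meas).pow_const 2) hu.fin.ne
  filter_upwards [this] with t ht
  simpa using ht

theorem IsQuartic.mono {I J : Set ℝ} {u : ℝ → ℤ → ℂ} (hu : IsQuartic I u) (hJ : J ⊆ I) :
    IsQuartic J u :=
  ⟨fun n => (hu.meas n).mono_set hJ, (lintegral_mono_set hJ).trans_lt hu.fin⟩

theorem sobolevSum_sub_le (r : ℝ) (c d : ℤ → ℂ) :
    sobolevSum r (fun n => c n - d n) ≤ 2 * (sobolevSum r c + sobolevSum r d) := by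
  have := sobolevSum_add_le r c (fun n => -d n)
  simpa [sub_eq_add_neg, sobolevSum] using this

theorem IsQuartic.sub {I : Set ℝ} {u v : ℝ → ℤ → ℂ} (hu : IsQuartic I u) (hv : IsQuartic I v) :
    IsQuartic I (fun t n => u t n - v t n) := by
  refine ⟨fun n => (hu.meas n).sub (hv.meas n), ?_⟩
  have hm := (aemeasurable_sobolevSum (9 / 2) hu.meas).pow_const 2
  calc _ ≤ ∫⁻ t in I, 8 * (sobolevSum (9 / 2) (u t) ^ 2 + sobolevSum (9 / 2) (v t) ^ 2) := by
        refine lintegral_mono fun t => ?_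
        calc _ ≤ (2 * (sobolevSum (9 / 2) (u t) + sobolevSum (9 / 2) (v t))) ^ 2 := by
              gcongr; exact sobolevSum_sub_le _ _ _
          _ ≤ 4 * (2 * (sobolevSum (9 / 2) (u t) ^ 2 + sobolevSum (9 / 2) (v t) ^ 2)) := by
              rw [mul_pow]
              norm_num only
              gcongr; exact add_sq_le_two_mul _ _
          _ = _ := by ring
    _ = 8 * (quarticNorm I u + quarticNorm I v) := by
        rw [lintegral_const_mul' _ _ (by norm_num), lintegral_add_left' hm]; rfl
    _ < ∞ := ENNReal.mul_lt_top (by norm_num) (ENNReal.add_lt_top.2 ⟨hu.fin, hv.fin⟩)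

theorem IsQuartic.aestronglyMeasurable_bilinear {I : Set ℝ} {u v : ℝ → ℤ → ℂ}
    (hu : IsQuartic I u) (hv : IsQuartic I v) (n : ℤ) :
    AEStronglyMeasurable (fun t => bilinear (u t) (v t) n) (volume.restrict I) := by
  refine aestronglyMeasurable_of_tendsto_ae (atTop : Filter (Finset ℤ))
    (f := fun s t => ∑ k ∈ s, symbol n k * (u t k * v t (n - k))) (fun s => ?_) ?_
  · refine Finset.aestronglyMeasurable_fun_sum s fun k _ => ?_
    exact ((hu.meas k).mul (hv.meas (n - k))).const_mul _
  · filter_upwards [hu.ae_lt_top, hv.ae_lt_top] with t h1 h2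
    exact (summable_bilinear h1 h2 n).hasSum

theorem IsQuartic.aemeasurable_energy_bilinear {I : Set ℝ} {u v : ℝ → ℤ → ℂ}
    (hu : IsQuartic I u) (hv : IsQuartic I v) :
    AEMeasurable (fun t => energy (bilinear (u t) (v t))) (volume.restrict I) :=
  AEMeasurable.tsum fun n => (hu.aestronglyMeasurable_bilinear hv n).enorm.pow_const 2

theorem IsQuartic.sq_lintegral_energy_bilinear_le {I : Set ℝ} {u v : ℝ → ℤ → ℂ}
    (hu : IsQuartic I u) (hv : IsQuartic I v) :
    (∫⁻ t in I, energy (bilinear (u t) (v t))) ^ 2 ≤ 16 * (quarticNorm I u * quarticNorm I v) :=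
  CapillaryMuskat.sq_lintegral_energy_bilinear_le (aemeasurable_sobolevSum _ hu.meas)
    (aemeasurable_sobolevSum _ hv.meas)

/-- With `w = u - v`, the difference is `B(w, u) + B(v, w)`, and each term obeys the bilinear
estimate. The constant is `4 · 2 · 16`. -/
theorem IsQuartic.sq_lintegral_energy_bilinear_sub_le {I : Set ℝ} {u v : ℝ → ℤ → ℂ}
    (hu : IsQuartic I u) (hv : IsQuartic I v) :
    (∫⁻ t in I, energy (fun n => bilinear (u t) (u t) n - bilinear (v t) (v t) n)) ^ 2 ≤
      128 * (quarticNorm I (fun t n => u t n - v t n) * (quarticNorm I u + quarticNorm I v)) := by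
  have hw := hu.sub hv
  set w : ℝ → ℤ → ℂ := fun t n => u t n - v t n with hwdef
  calc _ ≤ (∫⁻ t in I, 2 * (energy (bilinear (w t) (u t)) + energy (bilinear (v t) (w t)))) ^ 2 := by
        gcongr 1
        refine lintegral_mono_ae ?_
        filter_upwards [hu.ae_lt_top, hv.ae_lt_top, hw.ae_lt_top] with t h1 h2 h3
        rw [funext fun n => bilinear_sub h1 h2 h3 n]
        exact energy_add_le _ _
    _ = 4 * ((∫⁻ t in I, energy (bilinear (w t) (u t))) +
          ∫⁻ t in I, energy (bilinear (v t) (w t))) ^ 2 := by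
        rw [lintegral_const_mul' _ _ (by norm_num),
          lintegral_add_left' (hw.aemeasurable_energy_bilinear hu), mul_pow]
        norm_num
    _ ≤ 4 * (2 * (16 * (quarticNorm I w * quarticNorm I u) +
          16 * (quarticNorm I v * quarticNorm I w))) := by
        gcongr
        refine (add_sq_le_two_mul _ _).trans ?_
        gcongr
        · exact hw.sq_lintegral_energy_bilinear_le hu
        · exact hv.sq_lintegral_energy_bilinear_le hw
    _ = _ := by ring

/-- The forcing `∂ₓ [ℋ, u] Λ³ u` on `I`, extended by zero. -/
def source (I : Set ℝ) (u : ℝ → ℤ → ℂ) : ℝ → ℤ → ℂ := I.indicator fun t => bilinear (u t) (u t)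

theorem source_of_mem {I : Set ℝ} {t : ℝ} (ht : t ∈ I) (u : ℝ → ℤ → ℂ) :
    source I u t = bilinear (u t) (u t) := indicator_of_mem ht _

theorem source_of_notMem {I : Set ℝ} {t : ℝ} (ht : t ∉ I) (u : ℝ → ℤ → ℂ) :
    source I u t = 0 := indicator_of_notMem ht _

theorem lintegral_energy_source {I : Set ℝ} (hI : MeasurableSet I) (u : ℝ → ℤ → ℂ) :
    ∫⁻ t, energy (source I u t) = ∫⁻ t in I, energy (bilinear (u t) (u t)) := by
  rw [← lintegral_indicator hI]
  refine lintegral_congr fun t => ?_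
  by_cases ht : t ∈ I
  · rw [source_of_mem ht, indicator_of_mem ht]
  · rw [source_of_notMem ht, indicator_of_notMem ht]; simp [energy]

theorem IsQuartic.isForcing_source {I : Set ℝ} (hI : MeasurableSet I) {u : ℝ → ℤ → ℂ}
    (hu : IsQuartic I u) : IsForcing (source I u) := by
  refine ⟨fun n => ?_, ?_⟩
  · have h := (aestronglyMeasurable_indicator_iff hI).2 (hu.aestronglyMeasurable_bilinear hu n)
    refine h.congr (Eventually.of_forall fun t => ?_)
    by_cases ht : t ∈ I
    · simp only [source_of_mem ht, indicator_of_mem ht]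
    · simp only [source_of_notMem ht, indicator_of_notMem ht, Pi.zero_apply]
  · rw [lintegral_energy_source hI]
    have := (hu.sq_lintegral_energy_bilinear_le hu).trans_lt
      (ENNReal.mul_lt_top (by norm_num) (ENNReal.mul_lt_top hu.fin hu.fin))
    simpa using this

theorem IsForcing.lintegral_restrict_lt_top {F : ℝ → ℤ → ℂ} (hF : IsForcing F) (I : Set ℝ) :
    ∫⁻ t in I, energy (F t) < ∞ :=
  (lintegral_mono' Measure.restrict_le_self le_rfl).trans_lt hF.fin

theorem IsForcing.isQuartic_duhamel {I : Set ℝ} (hI : IsTimeSet I) {c : ℤ → ℂ}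
    (hc : sobolevSum 3 c < ∞) {F : ℝ → ℤ → ℂ} (hF : IsForcing F) : IsQuartic I (duhamel c F) := by
  refine ⟨fun n => (hF.continuous_duhamel c n).aestronglyMeasurable, ?_⟩
  refine (quarticNorm_duhamel_le c F).trans_lt (ENNReal.mul_lt_top (by norm_num) ?_)
  exact ENNReal.add_lt_top.2 ⟨(quarticNorm_free_le hI c).trans_lt (ENNReal.pow_lt_top hc),
    (quarticNorm_forced_le hI hF).trans_lt (ENNReal.pow_lt_top (hF.lintegral_restrict_lt_top I))⟩

/-! ### Mild solutions -/

/-- `F` is the nonlinear forcing of a mild solution on `I` with datum `c`; the solution is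
`duhamel c F`. -/
structure IsMild (I : Set ℝ) (c : ℤ → ℂ) (F : ℝ → ℤ → ℂ) : Prop where
  forcing : IsForcing F
  eq : ∀ᵐ t ∂volume, F t = source I (duhamel c F) t

theorem duhamel_congr (c : ℤ → ℂ) {F G : ℝ → ℤ → ℂ} (h : ∀ᵐ t ∂volume, F t = G t) :
    duhamel c F = duhamel c G := by
  ext t n
  unfold duhamel forced
  congr 2
  refine intervalIntegral.integral_congr_ae ?_
  filter_upwards [h] with τ hτ _
  rw [hτ]

/-! ### Uniqueness of mild solutions -/

theorem forced_eq_zero {J : Set ℝ} (hJ : IsTimeSet J) {F : ℝ → ℤ → ℂ} (hF : IsForcing F)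
    (h : ∫⁻ t in J, energy (F t) = 0) {t : ℝ} (ht : t ∈ J) (n : ℤ) : forced F t n = 0 := by
  rw [← enorm_eq_zero, ← nonpos_iff_eq_zero]
  refine (enorm_forced_le hJ F ht n).trans (le_of_eq ?_)
  have h0 := (lintegral_eq_zero_iff' hF.aemeasurable_energy.restrict).1 h
  refine (lintegral_congr_ae ?_).trans lintegral_zero
  filter_upwards [h0] with τ hτ
  have := (enorm_sq_le_energy (F τ) n).trans_eq hτ
  have : ‖F τ n‖ₑ = 0 := by simpa using this
  simp only [this, mul_zero]

theorem IsMild.lintegral_energy_sub_eq_zero {I J : Set ℝ} {c : ℤ → ℂ} {F G : ℝ → ℤ → ℂ}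
    (hF : IsMild I c F) (hG : IsMild I c G) (hJ : MeasurableSet J) (hJI : J ⊆ I)
    (h : ∀ t ∈ J, ∀ n, duhamel c F t n = duhamel c G t n) :
    ∫⁻ t in J, energy (fun n => F t n - G t n) = 0 := by
  refine (lintegral_congr_ae ?_).trans lintegral_zero
  filter_upwards [ae_restrict_of_ae hF.eq, ae_restrict_of_ae hG.eq, ae_restrict_mem hJ]
    with t h1 h2 ht
  rw [h1, h2, source_of_mem (hJI ht), source_of_mem (hJI ht), funext (h t ht)]
  simp [energy]

theorem IsMild.sq_lintegral_energy_sub_le {I J : Set ℝ} {c : ℤ → ℂ} {F G : ℝ → ℤ → ℂ}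
    (hI : IsTimeSet I) (hc : sobolevSum 3 c < ∞)
    (hF : IsMild I c F) (hG : IsMild I c G) (hJ : MeasurableSet J) (hJI : J ⊆ I) :
    (∫⁻ t in J, energy (fun n => F t n - G t n)) ^ 2 ≤
      128 * (quarticNorm J (forced (fun t n => F t n - G t n)) *
        (quarticNorm J (duhamel c F) + quarticNorm J (duhamel c G))) := by
  have h := ((hF.forcing.isQuartic_duhamel hI hc).mono hJI).sq_lintegral_energy_bilinear_sub_le
    ((hG.forcing.isQuartic_duhamel hI hc).mono hJI)
  simp only [duhamel_sub c hF.forcing hG.forcing] at h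
  refine le_trans (le_of_eq ?_) h
  congr 1
  refine lintegral_congr_ae ?_
  filter_upwards [ae_restrict_of_ae hF.eq, ae_restrict_of_ae hG.eq, ae_restrict_mem hJ]
    with t h1 h2 ht
  rw [h1, h2, source_of_mem (hJI ht), source_of_mem (hJI ht)]

/-- A continuation argument: if two solutions agree before `x`, then on a short interval after `x`
their `L⁴Ḣ^{9/4}` norms are small, and the difference estimate makes the energy of `F - G` at most a
fixed fraction of itself. No smallness of the solutions on all of `I` is needed. -/
theorem IsMild.eq_of_isMild {I : Set ℝ} {c : ℤ → ℂ} {F G : ℝ → ℤ → ℂ}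
    (hI : IsTimeSet I) (hc : sobolevSum 3 c < ∞)
    (hF : IsMild I c F) (hG : IsMild I c G) {b : ℝ} (hb : b ∈ I) (n : ℤ) :
    duhamel c F b n = duhamel c G b n := by
  have hFG := hF.forcing.sub hG.forcing
  set D : ℝ → ℤ → ℂ := fun t n => F t n - G t n with hD
  have hsub : ∀ t n, duhamel c F t n - duhamel c G t n = forced D t n :=
    duhamel_sub c hF.forcing hG.forcing
  -- The times before which the two solutions agree. As a set of lower bounds it is closed with no
  -- continuity argument.
  set s : Set ℝ := {t | ∀ τ, (0 ≤ τ ∧ ∃ n, forced D τ n ≠ 0) → t ≤ τ} with hs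
  have hs_mem : ∀ {t}, t ∈ s → ∀ τ ∈ Ico 0 t, ∀ n, duhamel c F τ n = duhamel c G τ n := by
    intro t ht τ hτ n
    rw [← sub_eq_zero, hsub]
    by_contra hne
    exact absurd (ht τ ⟨hτ.1, n, hne⟩) (not_le.2 hτ.2)
  have hclosed : IsClosed s := by
    simp only [hs, ofPred_forall]
    exact isClosed_iInter fun τ => isClosed_iInter fun _ => isClosed_Iic
  have hIcc := hI.Icc_subset b hb
  have hsubset : Icc 0 b ⊆ s := by
    refine (hclosed.inter isClosed_Icc).Icc_subset_of_forall_exists_gt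
      (fun τ hτ => hτ.1) ?_
    rintro x ⟨hxs, hx0, hxb⟩ y hxy
    set φ : ℝ → ℝ≥0∞ := fun t => sobolevSum (9 / 2) (duhamel c F t) ^ 2 +
      sobolevSum (9 / 2) (duhamel c G t) ^ 2
    have hφm : Measurable fun t => sobolevSum (9 / 2) (duhamel c F t) ^ 2 :=
      (measurable_sobolevSum _ (hF.forcing.continuous_duhamel c)).pow_const 2
    have hφ : ∀ J, ∫⁻ t in J, φ t =
        quarticNorm J (duhamel c F) + quarticNorm J (duhamel c G) := fun J =>
      lintegral_add_left hφm _
    have hφI : ∫⁻ t in I, φ t ≠ ∞ := by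
      rw [hφ]
      exact ENNReal.add_ne_top.2 ⟨(hF.forcing.isQuartic_duhamel hI hc).fin.ne,
        (hG.forcing.isQuartic_duhamel hI hc).fin.ne⟩
    -- Absolute continuity of the integral. The threshold makes `128 · 256⁻¹ = 1/2` in the
    -- difference estimate.
    obtain ⟨δ, hδ, hsmall⟩ := exists_pos_setLIntegral_lt_of_measure_lt hφI
      (ε := 256⁻¹) (by norm_num)
    obtain ⟨ρ, hρ, hρδ⟩ : ∃ ρ : ℝ, 0 < ρ ∧ ENNReal.ofReal ρ < δ := by
      obtain ⟨q, hq0, hqδ⟩ := ENNReal.lt_iff_exists_nnreal_btwn.1 hδ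
      exact ⟨q, by exact_mod_cast hq0, by simpa using hqδ⟩
    set z := min y (min b (x + ρ)) with hz
    have hxz : x < z := lt_min hxy (lt_min hxb (by linarith))
    have hzb : z ≤ b := (min_le_right _ _).trans (min_le_left _ _)
    have hzρ : z ≤ x + ρ := (min_le_right _ _).trans (min_le_right _ _)
    refine ⟨z, ?_, hxz, min_le_left _ _⟩
    have hzI : Icc 0 z ⊆ I := (Icc_subset_Icc_right hzb).trans hIcc
    have hxzI : Icc x z ⊆ I := (Icc_subset_Icc_left hx0).trans hzI
    have hsm : ∫⁻ t in Icc x z, φ t ≤ 256⁻¹ := by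
      refine le_trans (lintegral_mono' ?_ le_rfl) (hsmall (Icc x z) ?_).le
      · rw [Measure.restrict_restrict measurableSet_Icc, inter_eq_left.2 hxzI]
      · refine (Measure.restrict_apply_le _ _).trans_lt (lt_of_le_of_lt ?_ hρδ)
        rw [Real.volume_Icc]
        exact ENNReal.ofReal_le_ofReal (by linarith)
    -- The linear estimate is available on intervals starting at `0`, while smallness is known only
    -- on `[x, z]`. The two energies agree because `D` vanishes almost everywhere before `x`.
    have hE : ∫⁻ t in Icc 0 z, energy (D t) ≤ ∫⁻ t in Icc x z, energy (D t) := by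
      rw [← Ico_union_Icc_eq_Icc hx0 hxz.le]
      refine (lintegral_union_le _ _ _).trans ?_
      rw [hF.lintegral_energy_sub_eq_zero hG measurableSet_Ico
        (fun τ hτ => hzI ⟨hτ.1, hτ.2.le.trans hxz.le⟩) (hs_mem hxs), zero_add]
    have hE2 : (∫⁻ t in Icc 0 z, energy (D t)) ^ 2 ≤
        2⁻¹ * (∫⁻ t in Icc 0 z, energy (D t)) ^ 2 :=
      calc _ ≤ (∫⁻ t in Icc x z, energy (D t)) ^ 2 := by gcongr
        _ ≤ 128 * (quarticNorm (Icc x z) (forced D) *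
            (quarticNorm (Icc x z) (duhamel c F) + quarticNorm (Icc x z) (duhamel c G))) :=
          hF.sq_lintegral_energy_sub_le hI hc hG measurableSet_Icc hxzI
        _ ≤ 128 * ((∫⁻ t in Icc 0 z, energy (D t)) ^ 2 * 256⁻¹) := by
          rw [← hφ]
          gcongr
          exact (lintegral_mono_set (Icc_subset_Icc_left hx0)).trans
            (quarticNorm_forced_le (isTimeSet_Icc z) hFG)
        _ = (128 * 256⁻¹) * (∫⁻ t in Icc 0 z, energy (D t)) ^ 2 := by ring
        _ = _ := by
          congr 1
          rw [show (256 : ℝ≥0∞) = 128 * 2 by norm_num,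
            ENNReal.mul_inv (Or.inl (by norm_num)) (Or.inl (by norm_num)), ← mul_assoc,
            ENNReal.mul_inv_cancel (by norm_num) (by norm_num), one_mul]
    have hE0 : ∫⁻ t in Icc 0 z, energy (D t) = 0 := by
      by_contra hne
      have hfin : (∫⁻ t in Icc 0 z, energy (D t)) ^ 2 ≠ ∞ :=
        ENNReal.pow_ne_top (hFG.lintegral_restrict_lt_top _).ne
      have h0 : (∫⁻ t in Icc 0 z, energy (D t)) ^ 2 ≠ 0 := pow_ne_zero _ hne
      rw [mul_comm, ← div_eq_mul_inv] at hE2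
      exact absurd hE2 (not_le.2 (ENNReal.half_lt_self h0 hfin))
    rintro τ ⟨hτ0, m, hτ⟩
    by_contra hlt
    exact hτ (forced_eq_zero (isTimeSet_Icc z) hFG hE0 ⟨hτ0, (not_le.1 hlt).le⟩ m)
  have hb0 := hI.nonneg b hb
  have hE0 : ∫⁻ t in Icc 0 b, energy (D t) = 0 := by
    -- Membership of `b` in `s` gives agreement only on `[0, b)`; the endpoint is a null set for the
    -- energy.
    rw [← Ico_union_Icc_eq_Icc hb0 le_rfl, Icc_self]
    refine le_antisymm ((lintegral_union_le _ _ _).trans ?_) zero_le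
    rw [hF.lintegral_energy_sub_eq_zero hG measurableSet_Ico
      (Ico_subset_Icc_self.trans hIcc) (hs_mem (hsubset (right_mem_Icc.2 hb0))), zero_add]
    simp
  rw [← sub_eq_zero, hsub]
  exact forced_eq_zero (isTimeSet_Icc b) hFG hE0 (right_mem_Icc.2 hb0) n

/-! ### Existence by contraction in the space of forcings -/

/-- The space `L²(ℝ × ℤ)` of forcings. -/
abbrev ForcingSpace : Type := Lp ℂ 2 ((volume : Measure ℝ).prod (Measure.count : Measure ℤ))

theorem eLpNorm_two_sq {f : ℝ × ℤ → ℂ}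
    (hf : AEStronglyMeasurable f ((volume : Measure ℝ).prod (Measure.count : Measure ℤ))) :
    eLpNorm f 2 ((volume : Measure ℝ).prod (Measure.count : Measure ℤ)) ^ 2 =
      ∫⁻ t, energy (fun n => f (t, n)) := by
  rw [eLpNorm_eq_lintegral_rpow_enorm_toReal (by norm_num) (by norm_num), ← ENNReal.rpow_natCast,
    ← ENNReal.rpow_mul]
  norm_num
  rw [lintegral_prod _ (hf.enorm.pow_const 2)]
  simp only [lintegral_count, energy]

theorem ae_prod_count_iff {p : ℝ → ℤ → Prop} :
    (∀ᵐ x ∂((volume : Measure ℝ).prod (Measure.count : Measure ℤ)), p x.1 x.2) ↔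
      ∀ᵐ t ∂(volume : Measure ℝ), ∀ n, p t n := by
  constructor
  · intro h
    filter_upwards [Measure.ae_ae_of_ae_prod h] with t ht n
    have := (Measure.ae_count_iff).1 ht
    exact this n
  · intro h
    rw [ae_iff] at h ⊢
    refine measure_mono_null (t := {t | ¬ ∀ n, p t n} ×ˢ univ) (fun x hx => ?_) ?_
    · exact ⟨fun h' => hx (h' x.2), trivial⟩
    · rw [Measure.prod_prod, h, zero_mul]

theorem IsForcing.memLp_uncurry {F : ℝ → ℤ → ℂ} (hF : IsForcing F) :
    MemLp (Function.uncurry F) 2 ((volume : Measure ℝ).prod (Measure.count : Measure ℤ)) := by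
  have hm : AEStronglyMeasurable (Function.uncurry F)
      ((volume : Measure ℝ).prod (Measure.count : Measure ℤ)) := by
    -- Joint measurability is obtained by choosing a measurable representative of each of the
    -- countably many modes.
    refine ⟨fun x => (hF.meas x.2).mk _ x.1, ?_, ?_⟩
    · refine Measurable.stronglyMeasurable ?_
      exact measurable_from_prod_countable_left fun n => (hF.meas n).stronglyMeasurable_mk.measurable
    · exact (ae_prod_count_iff (p := fun t n => F t n = (hF.meas n).mk _ t)).2
        (ae_all_iff.2 fun n => (hF.meas n).ae_eq_mk)
  refine ⟨hm, ?_⟩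
  have := eLpNorm_two_sq hm
  have h2 : eLpNorm (Function.uncurry F) 2
      ((volume : Measure ℝ).prod (Measure.count : Measure ℤ)) ^ 2 < ∞ := this ▸ hF.fin
  simpa using h2

theorem isForcing_coeFn (F : ForcingSpace) : IsForcing (fun t n => F (t, n)) := by
  refine ⟨fun n => ?_, ?_⟩
  · have : Measurable fun t : ℝ => (t, n) := by fun_prop
    exact ((Lp.stronglyMeasurable F).comp_measurable this).aestronglyMeasurable
  · rw [← eLpNorm_two_sq (Lp.aestronglyMeasurable F)]
    exact ENNReal.pow_lt_top (Lp.eLpNorm_lt_top F)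

theorem enorm_sq_eq_lintegral_energy (F : ForcingSpace) :
    ‖F‖ₑ ^ 2 = ∫⁻ t, energy (fun n => F (t, n)) := by
  rw [Lp.enorm_def, eLpNorm_two_sq (Lp.aestronglyMeasurable F)]

theorem enorm_toLp_sub_sq {F G : ℝ → ℤ → ℂ} (hF : IsForcing F) (hG : IsForcing G) :
    ‖hF.memLp_uncurry.toLp _ - hG.memLp_uncurry.toLp _‖ₑ ^ 2 =
      ∫⁻ t, energy (fun n => F t n - G t n) := by
  rw [← MemLp.toLp_sub, Lp.enorm_toLp, eLpNorm_two_sq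
    (hF.memLp_uncurry.sub hG.memLp_uncurry).aestronglyMeasurable]
  rfl

theorem enorm_toLp_sq {F : ℝ → ℤ → ℂ} (hF : IsForcing F) :
    ‖hF.memLp_uncurry.toLp _‖ₑ ^ 2 = ∫⁻ t, energy (F t) := by
  rw [Lp.enorm_toLp, eLpNorm_two_sq hF.memLp_uncurry.aestronglyMeasurable]
  rfl

theorem enorm_sub_sq_eq_lintegral_energy (F G : ForcingSpace) :
    ‖F - G‖ₑ ^ 2 = ∫⁻ t, energy (fun n => F (t, n) - G (t, n)) := by
  rw [enorm_sq_eq_lintegral_energy]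
  refine lintegral_congr_ae ?_
  filter_upwards [(ae_prod_count_iff (p := fun t n => (F - G : ForcingSpace) (t, n) =
    F (t, n) - G (t, n))).1 (Lp.coeFn_sub F G)] with t ht
  rw [funext ht]

/-- The map `F ↦ ∂ₓ [ℋ, u] Λ³ u`, where `u` is the solution of the linear equation with datum `c`
and forcing `F`. -/
def picard {I : Set ℝ} (hI : IsTimeSet I) {c : ℤ → ℂ} (hc : sobolevSum 3 c < ∞)
    (F : ForcingSpace) : ForcingSpace :=
  (((isForcing_coeFn F).isQuartic_duhamel hI hc).isForcing_source
    hI.measurableSet).memLp_uncurry.toLp _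

theorem quarticNorm_duhamel_coeFn_le {I : Set ℝ} (hI : IsTimeSet I) (c : ℤ → ℂ) (F : ForcingSpace) :
    quarticNorm I (duhamel c fun t n => F (t, n)) ≤ 8 * (quarticNorm I (free c) + ‖F‖ₑ ^ 4) := by
  refine (quarticNorm_duhamel_le c _).trans ?_
  gcongr
  refine (quarticNorm_forced_le hI (isForcing_coeFn F)).trans ?_
  rw [show (4 : ℕ) = 2 * 2 by norm_num, pow_mul, enorm_sq_eq_lintegral_energy]
  gcongr
  exact Measure.restrict_le_self

theorem picard_enorm_pow_le {I : Set ℝ} (hI : IsTimeSet I) {c : ℤ → ℂ} (hc : sobolevSum 3 c < ∞)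
    (F : ForcingSpace) :
    ‖picard hI hc F‖ₑ ^ 4 ≤ 16 * quarticNorm I (duhamel c fun t n => F (t, n)) ^ 2 := by
  have hU := (isForcing_coeFn F).isQuartic_duhamel hI hc
  rw [show (4 : ℕ) = 2 * 2 by norm_num, pow_mul, picard,
    enorm_toLp_sq (hU.isForcing_source hI.measurableSet),
    lintegral_energy_source hI.measurableSet, sq (quarticNorm _ _)]
  exact hU.sq_lintegral_energy_bilinear_le hU

theorem picard_sub_enorm_pow_le {I : Set ℝ} (hI : IsTimeSet I) {c : ℤ → ℂ}
    (hc : sobolevSum 3 c < ∞) (F G : ForcingSpace) :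
    ‖picard hI hc F - picard hI hc G‖ₑ ^ 4 ≤ 128 * (‖F - G‖ₑ ^ 4 *
      (quarticNorm I (duhamel c fun t n => F (t, n)) +
        quarticNorm I (duhamel c fun t n => G (t, n)))) := by
  have hF := isForcing_coeFn F
  have hG := isForcing_coeFn G
  have hU := hF.isQuartic_duhamel hI hc
  have hV := hG.isQuartic_duhamel hI hc
  have h := hU.sq_lintegral_energy_bilinear_sub_le hV
  simp only [duhamel_sub c hF hG] at h
  rw [show (4 : ℕ) = 2 * 2 by norm_num, pow_mul, pow_mul, picard, picard,
    enorm_toLp_sub_sq (hU.isForcing_source hI.measurableSet)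
      (hV.isForcing_source hI.measurableSet), enorm_sub_sq_eq_lintegral_energy]
  calc _ = (∫⁻ t in I, energy (fun n => bilinear (duhamel c (fun t n => F (t, n)) t)
          (duhamel c (fun t n => F (t, n)) t) n - bilinear (duhamel c (fun t n => G (t, n)) t)
          (duhamel c (fun t n => G (t, n)) t) n)) ^ 2 := by
        rw [← lintegral_indicator hI.measurableSet]
        congr 1
        refine lintegral_congr fun t => ?_
        by_cases ht : t ∈ I
        · rw [source_of_mem ht, source_of_mem ht, indicator_of_mem ht]
        · rw [source_of_notMem ht, source_of_notMem ht, indicator_of_notMem ht]; simp [energy]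
    _ ≤ _ := h
    _ ≤ _ := by
        gcongr
        refine (quarticNorm_forced_le hI (hF.sub hG)).trans ?_
        gcongr
        exact Measure.restrict_le_self

/-- Banach's fixed point theorem on the ball of radius `1/16` of `L²(ℝ × ℤ)`. On it the quartic norm
of the solution is at most `8 · 2 · 16⁻⁴ = 16⁻³`, so the fourth power of the norm of the image is at
most `16 · 16⁻⁶ ≤ 16⁻⁴`. The contraction factor to the fourth power is `128 · 2 · 16⁻³ = 16⁻¹ =
(1/2)⁴`. -/
theorem exists_isMild {I : Set ℝ} (hI : IsTimeSet I) {c : ℤ → ℂ} (hc : sobolevSum 3 c < ∞)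
    (hsmall : quarticNorm I (free c) ≤ 16⁻¹ ^ 4) : ∃ F, IsMild I c F := by
  set s : Set ForcingSpace := {F | ‖F‖ₑ ≤ 16⁻¹} with hs
  have hsc : IsComplete s := (isClosed_le continuous_enorm continuous_const).isComplete
  have h16 : (16 : ℝ≥0∞) * 16⁻¹ = 1 := ENNReal.mul_inv_cancel (by norm_num) (by norm_num)
  have hQ : ∀ F ∈ s, quarticNorm I (duhamel c fun t n => F (t, n)) ≤ 16⁻¹ ^ 3 := fun F hF =>
    calc _ ≤ 8 * (quarticNorm I (free c) + ‖F‖ₑ ^ 4) := quarticNorm_duhamel_coeFn_le hI c F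
      _ ≤ 8 * (16⁻¹ ^ 4 + 16⁻¹ ^ 4) := by gcongr; exact hF
      _ = (16 * 16⁻¹) * 16⁻¹ ^ 3 := by ring
      _ = 16⁻¹ ^ 3 := by rw [h16, one_mul]
  have hmaps : MapsTo (picard hI hc) s s := fun F hF => by
    refine (ENNReal.pow_le_pow_left_iff (n := 4) (by norm_num)).1 ?_
    calc _ ≤ 16 * (16⁻¹ ^ 3) ^ 2 := (picard_enorm_pow_le hI hc F).trans (by gcongr; exact hQ F hF)
      _ = (16 * 16⁻¹) * (16⁻¹ ^ 4 * 16⁻¹) := by ring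
      _ ≤ 1 * (16⁻¹ ^ 4 * 1) := by rw [h16]; gcongr; norm_num
      _ = 16⁻¹ ^ 4 := by ring
  have hcontr : ContractingWith 2⁻¹ (hmaps.restrict (picard hI hc) s s) := by
    refine ⟨by rw [← NNReal.coe_lt_coe]; norm_num, fun F G => ?_⟩
    change edist (picard hI hc F) (picard hI hc G) ≤ _ * edist (F : ForcingSpace) G
    rw [edist_eq_enorm_sub, edist_eq_enorm_sub]
    refine (ENNReal.pow_le_pow_left_iff (n := 4) (by norm_num)).1 ?_
    have e : (((2⁻¹ : NNReal) : ℝ≥0∞)) ^ 4 = 16⁻¹ := by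
      rw [ENNReal.coe_inv (by norm_num), ← ENNReal.inv_pow]; norm_num
    rw [mul_pow, e]
    calc _ ≤ 128 * (‖(F : ForcingSpace) - G‖ₑ ^ 4 * (16⁻¹ ^ 3 + 16⁻¹ ^ 3)) :=
          (picard_sub_enorm_pow_le hI hc F G).trans (by
            gcongr
            · exact hQ F F.2
            · exact hQ G G.2)
      _ = (16 * 16⁻¹) * (16 * 16⁻¹) * (16⁻¹ * ‖(F : ForcingSpace) - G‖ₑ ^ 4) := by ring
      _ = _ := by rw [h16, one_mul, one_mul]
  obtain ⟨F, -, hF, -⟩ := hcontr.exists_fixedPoint' hsc hmaps (x := 0) (by simp [hs])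
    (edist_ne_top _ _)
  have hFf := isForcing_coeFn F
  have hS := (hFf.isQuartic_duhamel hI hc).isForcing_source hI.measurableSet
  refine ⟨fun t n => F (t, n), hFf, ?_⟩
  have h1 : F = hS.memLp_uncurry.toLp _ := hF.symm
  have h2 := hS.memLp_uncurry.coeFn_toLp
  rw [← h1] at h2
  have h3 := (ae_prod_count_iff (p := fun t n => F (t, n) =
    source I (duhamel c fun t n => F (t, n)) t n)).1 h2
  filter_upwards [h3] with t ht
  exact funext ht

/-! ### Complex conjugation -/

/-- The Fourier coefficients of the complex conjugate. -/
def conjCoeff (c : ℤ → ℂ) (n : ℤ) : ℂ := starRingEnd ℂ (c (-n))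

/-- The symbol is real and unchanged under `(n, k) ↦ (-n, -k)`, so the nonlinearity commutes with
complex conjugation. -/
theorem bilinear_conjCoeff (c d : ℤ → ℂ) :
    bilinear (conjCoeff c) (conjCoeff d) = conjCoeff (bilinear c d) := by
  ext n
  unfold bilinear conjCoeff
  rw [Complex.conj_tsum, ← (Equiv.neg ℤ).tsum_eq]
  congr 1; ext k
  have h1 : symbol n (-k) = symbol (-n) k := by
    unfold symbol
    congr 1
    rw [show -n - k = -(n - -k) by ring, abs_neg, Int.sign_neg, Int.sign_neg]; ring
  have h2 : starRingEnd ℂ (symbol (-n) k) = symbol (-n) k := by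
    unfold symbol; exact map_intCast _ _
  simp only [Equiv.neg_apply, map_mul, h1, h2, neg_neg]
  congr 4; ring

theorem energy_conjCoeff (c : ℤ → ℂ) : energy (conjCoeff c) = energy c := by
  unfold energy conjCoeff
  rw [← (Equiv.neg ℤ).tsum_eq (fun n => ‖c n‖ₑ ^ 2)]
  simp only [Equiv.neg_apply, ← ofReal_norm, RCLike.norm_conj]

theorem rate_neg (n : ℤ) : rate (-n) = rate n := by simp [rate]

theorem duhamel_conjCoeff (c : ℤ → ℂ) (F : ℝ → ℤ → ℂ) (t : ℝ) :
    duhamel (conjCoeff c) (fun t => conjCoeff (F t)) t = conjCoeff (duhamel c F t) := by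
  ext n
  unfold duhamel free forced conjCoeff
  simp only [map_add, map_mul, rate_neg, Complex.conj_ofReal, ← intervalIntegral.intervalIntegral_conj]

theorem IsMild.conjCoeff {I : Set ℝ} {c : ℤ → ℂ} {F : ℝ → ℤ → ℂ} (hF : IsMild I c F) :
    IsMild I (conjCoeff c) (fun t => conjCoeff (F t)) := by
  refine ⟨⟨fun n => ?_, ?_⟩, ?_⟩
  · exact Complex.continuous_conj.comp_aestronglyMeasurable (hF.forcing.meas (-n))
  · simpa only [energy_conjCoeff] using hF.forcing.fin
  · filter_upwards [hF.eq] with t ht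
    by_cases htI : t ∈ I
    · rw [ht, source_of_mem htI, source_of_mem htI, duhamel_conjCoeff, bilinear_conjCoeff]
    · rw [ht, source_of_notMem htI, source_of_notMem htI]
      ext n; simp [CapillaryMuskat.conjCoeff]

/-- The conjugate of a mild solution is a mild solution with the conjugate datum, so uniqueness
applies when the datum is real. -/
theorem IsMild.conjCoeff_duhamel {I : Set ℝ} {c : ℤ → ℂ} {F : ℝ → ℤ → ℂ} (hI : IsTimeSet I)
    (hc : sobolevSum 3 c < ∞) (hF : IsMild I c F) (hreal : CapillaryMuskat.conjCoeff c = c)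
    {t : ℝ} (ht : t ∈ I) :
    CapillaryMuskat.conjCoeff (duhamel c F t) = duhamel c F t := by
  have h := hF.conjCoeff
  rw [hreal] at h
  rw [← duhamel_conjCoeff, hreal]
  exact funext fun n => h.eq_of_isMild hI hc hF ht n

/-! ### Square-integrable functions and their Fourier coefficients -/

theorem coeff_eq_repr (u : L2) (n : ℤ) : coeff u n = fourierBasis.repr u n :=
  (fourierBasis_repr u n).symm

theorem coeff_sub (u v : L2) (n : ℤ) : coeff (u - v) n = coeff u n - coeff v n := by
  simp only [coeff_eq_repr, map_sub, lp.coeFn_sub, Pi.sub_apply]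

theorem coeff_injective {u v : L2} (h : ∀ n, coeff u n = coeff v n) : u = v := by
  apply fourierBasis.repr.injective
  ext n
  simpa only [coeff_eq_repr] using h n

theorem continuous_coeff (n : ℤ) : Continuous fun u : L2 => coeff u n := by
  simp only [coeff_eq_repr, HilbertBasis.repr_apply_apply]
  fun_prop

theorem enorm_sq_eq_energy (u : L2) : ‖u‖ₑ ^ 2 = energy (coeff u) := by
  have h := lp.hasSum_norm (p := 2) (by norm_num) (fourierBasis.repr u)
  norm_num at h
  unfold energy
  rw [← ofReal_norm, ← ENNReal.ofReal_pow (norm_nonneg _), ← h.tsum_eq,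
    ENNReal.ofReal_tsum_of_nonneg (fun n => by positivity) h.summable]
  congr 1; ext n
  rw [ENNReal.ofReal_pow (norm_nonneg _), ofReal_norm, coeff_eq_repr]

theorem memℓp_of_energy_lt_top {c : ℤ → ℂ} (h : energy c < ∞) : Memℓp c 2 := by
  refine memℓp_gen ?_
  refine Summable.of_enorm ?_
  have h' : ∀ n, ‖‖c n‖ ^ (2 : ℝ≥0∞).toReal‖ₑ = ‖c n‖ₑ ^ 2 := fun n => by
    rw [ENNReal.toReal_ofNat, Real.rpow_two, enorm_pow, enorm_norm]
  simp only [h']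
  exact h.ne

open Classical in
/-- The square-integrable function with Fourier coefficients `c`. -/
def ofCoeff (c : ℤ → ℂ) : L2 :=
  if h : Memℓp c 2 then fourierBasis.repr.symm ⟨c, h⟩ else 0

theorem coeff_ofCoeff {c : ℤ → ℂ} (h : energy c < ∞) : coeff (ofCoeff c) = c := by
  ext n
  rw [coeff_eq_repr, ofCoeff, dif_pos (memℓp_of_energy_lt_top h),
    LinearIsometryEquiv.apply_symm_apply]

theorem energy_le_sobolevSum {c : ℤ → ℂ} (h0 : c 0 = 0) {r : ℝ} (hr : 0 ≤ r) :
    energy c ≤ sobolevSum r c := by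
  refine ENNReal.tsum_le_tsum fun n => ?_
  by_cases hn : n = 0
  · subst hn; simp [h0]
  · calc _ = 1 * ‖c n‖ₑ ^ 2 := (one_mul _).symm
      _ ≤ _ := by gcongr; exact one_le_weight hr hn

theorem hdotNorm_rpow_four (s : ℝ) (u : L2) :
    hdotNorm s u ^ (4 : ℝ) = sobolevSum (2 * s) (coeff u) ^ 2 := by
  rw [hdotNorm_eq, ← ENNReal.rpow_natCast, ← ENNReal.rpow_mul]; norm_num

theorem hdotNorm_rpow_two (s : ℝ) (u : L2) :
    hdotNorm s u ^ (2 : ℝ) = sobolevSum (2 * s) (coeff u) := by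
  rw [← hdotNorm_sq, ← ENNReal.rpow_natCast]; norm_num

/-! ### Real-valued functions -/

theorem coeff_star (u : L2) : coeff (star u) = conjCoeff (coeff u) := by
  ext n
  have h : coeff (star u) n = fourierCoeff (fun x => starRingEnd ℂ ((u : Torus → ℂ) x)) n :=
    congrFun (fourierCoeff_congr_ae (Lp.coeFn_star u)) n
  rw [h, conjCoeff, coeff, fourierCoeff, fourierCoeff, ← integral_conj]
  congr 1; ext x
  simp only [smul_eq_mul, map_mul, neg_neg, ← fourier_neg]

theorem isRealValued_iff (u : L2) : IsRealValued u ↔ conjCoeff (coeff u) = coeff u := by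
  rw [← coeff_star]
  constructor
  · intro h
    congr 1
    refine Lp.ext ?_
    filter_upwards [Lp.coeFn_star u, h] with x hx hx'
    rw [hx]
    exact Complex.conj_eq_iff_im.2 hx'
  · intro h
    have h' : star u = u := coeff_injective (congrFun h)
    have h2 := Lp.coeFn_star u
    rw [h'] at h2
    filter_upwards [h2] with x hx
    exact Complex.conj_eq_iff_im.1 hx.symm

/-! ### Regularity of mild solutions -/

theorem bilinear_zero_right (c d : ℤ → ℂ) : bilinear c d 0 = 0 := by
  simp [bilinear, symbol]

theorem IsMild.duhamel_apply_zero {I : Set ℝ} {c : ℤ → ℂ} {F : ℝ → ℤ → ℂ} (hF : IsMild I c F)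
    (hc0 : c 0 = 0) (t : ℝ) : duhamel c F t 0 = 0 := by
  rw [duhamel_congr c hF.eq, duhamel, free, hc0, forced]
  have : ∀ τ, source I (duhamel c F) τ 0 = 0 := fun τ => by
    by_cases hτ : τ ∈ I
    · rw [source_of_mem hτ, bilinear_zero_right]
    · rw [source_of_notMem hτ]; rfl
  simp [this]

/-- A summable bound for the modes of `duhamel c F` on `I`. -/
def modeBound (I : Set ℝ) (c : ℤ → ℂ) (F : ℝ → ℤ → ℂ) (n : ℤ) : ℝ≥0∞ :=
  2 * (weight 3 n * ‖c n‖ₑ ^ 2 + ∫⁻ τ in I, ‖F τ n‖ₑ ^ 2)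

theorem weight_mul_duhamel_sq_le {I : Set ℝ} (hI : IsTimeSet I) (c : ℤ → ℂ) {F : ℝ → ℤ → ℂ}
    (hF : IsForcing F) {t : ℝ} (ht : t ∈ I) (n : ℤ) :
    weight 3 n * ‖duhamel c F t n‖ₑ ^ 2 ≤ modeBound I c F n :=
  calc _ ≤ weight 3 n * (2 * (‖free c t n‖ₑ ^ 2 + ‖forced F t n‖ₑ ^ 2)) := by
        gcongr; exact enorm_add_sq_le _ _
    _ = 2 * (weight 3 n * ‖free c t n‖ₑ ^ 2 + weight 3 n * ‖forced F t n‖ₑ ^ 2) := by ring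
    _ ≤ 2 * (weight 3 n * (1 * ‖c n‖ₑ ^ 2) + ∫⁻ τ in I, 1 * ‖F τ n‖ₑ ^ 2) := by
        refine mul_le_mul_right (add_le_add (mul_le_mul_right ?_ _) ?_) _
        · refine (enorm_free_sq_le c (hI.nonneg t ht) n).trans ?_
          gcongr; exact heatKernel_le_one _ _
        · refine (weight_mul_forced_sq_le hI hF ht n).trans (lintegral_mono fun τ => ?_)
          gcongr; exact heatKernel_le_one _ _
    _ = _ := by simp only [one_mul, modeBound]

theorem tsum_modeBound_lt_top {c : ℤ → ℂ} (hc : sobolevSum 3 c < ∞) {F : ℝ → ℤ → ℂ}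
    (hF : IsForcing F) (I : Set ℝ) : ∑' n, modeBound I c F n < ∞ := by
  unfold modeBound
  rw [ENNReal.tsum_mul_left, ENNReal.tsum_add, ← hF.lintegral_energy]
  exact ENNReal.mul_lt_top (by norm_num)
    (ENNReal.add_lt_top.2 ⟨hc, hF.lintegral_restrict_lt_top I⟩)

theorem sobolevSum_three_duhamel_lt_top {I : Set ℝ} (hI : IsTimeSet I) {c : ℤ → ℂ}
    (hc : sobolevSum 3 c < ∞) {F : ℝ → ℤ → ℂ} (hF : IsForcing F) {t : ℝ} (ht : t ∈ I) :
    sobolevSum 3 (duhamel c F t) < ∞ :=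
  (ENNReal.tsum_le_tsum fun n => weight_mul_duhamel_sq_le hI c hF ht n).trans_lt
    (tsum_modeBound_lt_top hc hF I)

/-- Each mode is continuous in time, and `modeBound` dominates all modes uniformly on `I`; dominated
convergence over `ℤ` then gives continuity in `Ḣ^{3/2}`. -/
theorem tendsto_sobolevSum_three_duhamel_sub {I : Set ℝ} (hI : IsTimeSet I) {c : ℤ → ℂ}
    (hc : sobolevSum 3 c < ∞) {F : ℝ → ℤ → ℂ} (hF : IsForcing F) {t : ℝ} (ht : t ∈ I) :
    Tendsto (fun τ => sobolevSum 3 fun n => duhamel c F τ n - duhamel c F t n) (𝓝[I] t) (𝓝 0) := by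
  unfold sobolevSum
  simp only [← lintegral_count]
  rw [show (0 : ℝ≥0∞) = ∫⁻ _ : ℤ, 0 ∂Measure.count by simp]
  refine tendsto_lintegral_filter_of_dominated_convergence (fun n => 4 * modeBound I c F n)
    (Eventually.of_forall fun τ => measurable_from_top) ?_ ?_ (ae_of_all _ fun n => ?_)
  · filter_upwards [self_mem_nhdsWithin] with τ hτ
    refine ae_of_all _ fun n => ?_
    have h : ‖duhamel c F τ n - duhamel c F t n‖ₑ ^ 2 ≤
        2 * (‖duhamel c F τ n‖ₑ ^ 2 + ‖duhamel c F t n‖ₑ ^ 2) := by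
      have := enorm_add_sq_le (duhamel c F τ n) (-duhamel c F t n)
      simpa [sub_eq_add_neg] using this
    calc _ ≤ weight 3 n * (2 * (‖duhamel c F τ n‖ₑ ^ 2 + ‖duhamel c F t n‖ₑ ^ 2)) := by gcongr
      _ = 2 * (weight 3 n * ‖duhamel c F τ n‖ₑ ^ 2 + weight 3 n * ‖duhamel c F t n‖ₑ ^ 2) := by ring
      _ ≤ 2 * (modeBound I c F n + modeBound I c F n) := by
          gcongr
          · exact weight_mul_duhamel_sq_le hI c hF hτ n
          · exact weight_mul_duhamel_sq_le hI c hF ht n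
      _ = _ := by ring
  · rw [lintegral_count, ENNReal.tsum_mul_left]
    exact (ENNReal.mul_lt_top (by norm_num) (tsum_modeBound_lt_top hc hF I)).ne
  · have h1 : Continuous fun τ => ‖duhamel c F τ n - duhamel c F t n‖ₑ ^ 2 :=
      (ENNReal.continuous_pow 2).comp
        ((hF.continuous_duhamel c n).sub continuous_const).enorm
    have h2 := (ENNReal.continuous_const_mul (weight_ne_top 3 n)).comp h1
    have h3 := (h2.tendsto t).mono_left (nhdsWithin_le_nhds (s := I))
    simpa [Function.comp_def] using h3

theorem lintegral_sobolevSum_six_duhamel_lt_top {I : Set ℝ} (hI : IsTimeSet I) {c : ℤ → ℂ}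
    (hc : sobolevSum 3 c < ∞) {F : ℝ → ℤ → ℂ} (hF : IsForcing F) :
    ∫⁻ t in I, sobolevSum 6 (duhamel c F t) < ∞ :=
  calc _ ≤ ∫⁻ t in I, 2 * (sobolevSum 6 (free c t) + sobolevSum 6 (forced F t)) :=
        lintegral_mono fun t => sobolevSum_add_le _ _ _
    _ = 2 * ((∫⁻ t in I, sobolevSum 6 (free c t)) + ∫⁻ t in I, sobolevSum 6 (forced F t)) := by
        rw [lintegral_const_mul' _ _ (by norm_num),
          lintegral_add_left (measurable_sobolevSum _ (continuous_free c))]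
    _ < ∞ := ENNReal.mul_lt_top (by norm_num) (ENNReal.add_lt_top.2
        ⟨(lintegral_sobolevSum_six_free_le hI c).trans_lt hc,
          (lintegral_sobolevSum_six_forced_le hI hF).trans_lt (hF.lintegral_restrict_lt_top I)⟩)

/-! ### Solutions in the sense of distributions are mild -/

/-- With zero average, each single mode is bounded by the `Ḣ^{9/4}` norm and hence lies in `L⁴` in
time. -/
theorem IsQuartic.locallyIntegrable_indicator {I : Set ℝ} (hI : MeasurableSet I) {u : ℝ → ℤ → ℂ}
    (hu : IsQuartic I u) (h0 : ∀ᵐ t ∂(volume.restrict I), u t 0 = 0) (n : ℤ) :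
    LocallyIntegrable (I.indicator fun t => u t n) volume := by
  have h : MemLp (fun t => u t n) 4 (volume.restrict I) := by
    refine ⟨hu.meas n, ?_⟩
    rw [eLpNorm_lt_top_iff_lintegral_rpow_enorm_lt_top (by norm_num) (by norm_num)]
    refine lt_of_le_of_lt (lintegral_mono_ae ?_) hu.fin
    filter_upwards [h0] with t ht
    calc ‖u t n‖ₑ ^ (4 : ℝ≥0∞).toReal = (‖u t n‖ₑ ^ 2) ^ 2 := by
          rw [← pow_mul, ← ENNReal.rpow_natCast]; norm_num
      _ ≤ _ := by
          gcongr
          exact (enorm_sq_le_energy _ n).trans (energy_le_sobolevSum ht (by norm_num))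
  exact ((memLp_indicator_iff_restrict hI).2 h).locallyIntegrable (by norm_num)

theorem isQuartic_coeff {T : ℝ≥0∞} {g : ℝ → L2} (hg : MemLpHdot 4 (9 / 4) T g) :
    IsQuartic (timeInterval T) fun t => coeff (g t) := by
  refine ⟨fun n => (continuous_coeff n).comp_aestronglyMeasurable hg.1, ?_⟩
  have := hg.2.2
  simp only [hdotNorm_rpow_four] at this
  norm_num at this
  exact this

theorem isMild_of_isSolution {T : ℝ≥0∞} {f₀ : L2} {g : ℝ → L2} (hg : MemLpHdot 4 (9 / 4) T g)
    (hsol : IsSolution T f₀ g) :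
    ∃ G, IsMild (timeInterval T) (coeff f₀) G ∧
      ∀ᵐ t ∂(volume.restrict (timeInterval T)), coeff (g t) = duhamel (coeff f₀) G t := by
  set I := timeInterval T with hIdef
  have hI : IsTimeSet I := isTimeSet_timeInterval T
  set u : ℝ → ℤ → ℂ := fun t => coeff (g t) with hu_def
  have hu : IsQuartic I u := isQuartic_coeff hg
  have hG : IsForcing (source I u) := hu.isForcing_source hI.measurableSet
  have h0 : ∀ᵐ t ∂(volume.restrict I), u t 0 = 0 := hg.2.1.mono fun t ht => ht.1
  have hrhs : ∀ᵐ t ∂volume, t ∈ I → ∀ n,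
      -calderonCube (coeff (g t)) n + nonlinearity (coeff (g t)) n =
      -((rate n : ℂ) * u t n) + source I u t n := by
    rw [← ae_restrict_iff' hI.measurableSet]
    filter_upwards [h0, hu.ae_lt_top, ae_restrict_mem hI.measurableSet] with t ht0 ht htI n
    rw [calderonCube_apply, nonlinearity_eq_bilinear ht0 ht, source_of_mem htI]
    rfl
  have hmodes : ∀ n, ∀ᵐ t ∂volume, t ∈ I → u t n = duhamel (coeff f₀) (source I u) t n := by
    intro n
    refine eq_duhamel_of_eq_integral (coeff f₀) hG (fun t ht => ⟨hI.nonneg t ht, hI.Icc_subset t ht⟩)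
      (v := fun t => u t n) (hu.locallyIntegrable_indicator hI.measurableSet h0 n) ?_
    filter_upwards [(ae_restrict_iff' hI.measurableSet).1 hsol] with t ht htI
    refine (ht htI n).trans (congrArg _ ?_)
    refine intervalIntegral.integral_congr_ae ?_
    filter_upwards [hrhs] with τ hτ hτt
    rw [uIoc_of_le (hI.nonneg t htI)] at hτt
    exact hτ (hI.Icc_subset t htI ⟨hτt.1.le, hτt.2⟩) n
  have hall : ∀ᵐ t ∂volume, t ∈ I → u t = duhamel (coeff f₀) (source I u) t := by
    filter_upwards [ae_all_iff.2 hmodes] with t ht htI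
    exact funext fun n => ht n htI
  refine ⟨source I u, ⟨hG, ?_⟩, (ae_restrict_iff' hI.measurableSet).2 hall⟩
  filter_upwards [hall] with t ht
  by_cases htI : t ∈ I
  · rw [source_of_mem htI, source_of_mem htI, ht htI]
  · rw [source_of_notMem htI, source_of_notMem htI]

/-! ### Well-posedness -/

/-- Smallness is required of the free evolution only, so the same statement serves short times and
small data. -/
theorem uniquelySolvable_of_quarticNorm_free_le {T : ℝ≥0∞} {f₀ : L2} (hf₀ : MemHdot (3 / 2) f₀)
    (hsmall : quarticNorm (timeInterval T) (free (coeff f₀)) ≤ 16⁻¹ ^ 4) :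
    UniquelySolvable T f₀ := by
  set I := timeInterval T with hIdef
  have hI : IsTimeSet I := isTimeSet_timeInterval T
  set c := coeff f₀ with hcdef
  have hc : sobolevSum 3 c < ∞ := by
    have := hdotNorm_lt_top.1 hf₀.2
    norm_num at this
    exact this
  obtain ⟨F, hF⟩ := exists_isMild hI hc hsmall
  have hU0 := hF.duhamel_apply_zero hf₀.1
  have hcoeff : ∀ t ∈ I, coeff (ofCoeff (duhamel c F t)) = duhamel c F t := fun t ht =>
    coeff_ofCoeff ((energy_le_sobolevSum (hU0 t) (by norm_num)).trans_lt
      (sobolevSum_three_duhamel_lt_top hI hc hF.forcing ht))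
  have hcoeff' : ∀ᵐ t ∂(volume.restrict I), coeff (ofCoeff (duhamel c F t)) = duhamel c F t := by
    filter_upwards [ae_restrict_mem hI.measurableSet] with t ht using hcoeff t ht
  have hUq := hF.forcing.isQuartic_duhamel hI hc
  have hcont : ContinuousHdot (3 / 2) T fun t => ofCoeff (duhamel c F t) := by
    intro t ht
    refine ⟨⟨by rw [hcoeff t ht, hU0], ?_⟩, ?_⟩
    · rw [hdotNorm_lt_top, hcoeff t ht]
      norm_num
      exact sobolevSum_three_duhamel_lt_top hI hc hF.forcing ht
    · have h := ((ENNReal.continuous_rpow_const (y := 1 / 2)).tendsto 0).comp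
        (tendsto_sobolevSum_three_duhamel_sub hI hc hF.forcing ht)
      rw [ENNReal.zero_rpow_of_pos (by norm_num)] at h
      refine h.congr' ?_
      filter_upwards [self_mem_nhdsWithin] with τ hτ
      rw [hdotNorm_eq, Function.comp_apply]
      simp only [funext (coeff_sub _ _), hcoeff t ht, hcoeff τ hτ]
      norm_num
  -- For zero average the `Ḣ^{3/2}` norm dominates the `L²` norm, so the curve is continuous in
  -- `L²`; this yields the strong measurability demanded by `MemLpHdot`.
  have hcontL2 : ContinuousOn (fun t => ofCoeff (duhamel c F t)) I := by
    intro t ht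
    rw [ContinuousWithinAt, tendsto_iff_edist_tendsto_0]
    have h := (hcont t ht).2
    refine tendsto_of_tendsto_of_tendsto_of_le_of_le' tendsto_const_nhds h
      (Eventually.of_forall fun _ => zero_le) ?_
    filter_upwards [self_mem_nhdsWithin] with τ hτ
    rw [edist_eq_enorm_sub]
    refine (ENNReal.pow_le_pow_left_iff (n := 2) (by norm_num)).1 ?_
    rw [enorm_sq_eq_energy, hdotNorm_sq]
    refine energy_le_sobolevSum ?_ (by norm_num)
    rw [coeff_sub, hcoeff t ht, hcoeff τ hτ, hU0, hU0, sub_zero]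
  have hmeas : AEStronglyMeasurable (fun t => ofCoeff (duhamel c F t)) (volume.restrict I) :=
    hcontL2.aestronglyMeasurable hI.measurableSet
  have h94 : MemLpHdot 4 (9 / 4) T fun t => ofCoeff (duhamel c F t) := by
    refine ⟨hmeas, ?_, ?_⟩
    · filter_upwards [hcoeff', hUq.ae_lt_top] with t ht h
      refine ⟨by rw [ht, hU0], ?_⟩
      rw [hdotNorm_lt_top, ht]
      norm_num
      exact h
    · refine lt_of_le_of_lt (lintegral_mono_ae ?_) hUq.fin
      filter_upwards [hcoeff'] with t ht
      rw [hdotNorm_rpow_four, ht]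
      norm_num
  have h6 := lintegral_sobolevSum_six_duhamel_lt_top hI hc hF.forcing
  refine ⟨fun t => ofCoeff (duhamel c F t), h94, ?_, ?_, ?_, hcont, ⟨hmeas, ?_, ?_⟩, ?_⟩
  · filter_upwards [ae_restrict_mem hI.measurableSet] with t ht n
    rw [hcoeff t ht, hF.forcing.duhamel_eq_integral]
    refine congrArg _ (intervalIntegral.integral_congr_ae ?_)
    filter_upwards [hF.eq, (ae_restrict_iff' hI.measurableSet).1 hUq.ae_lt_top] with τ h1 h2 hτ
    rw [uIoc_of_le (hI.nonneg t ht)] at hτ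
    have hτI : τ ∈ I := hI.Icc_subset t ht ⟨hτ.1.le, hτ.2⟩
    rw [hcoeff τ hτI, calderonCube_apply, nonlinearity_eq_bilinear (hU0 τ) (h2 hτI), h1,
      source_of_mem hτI]
    rfl
  · intro g hg hsol
    obtain ⟨G, hG, hgG⟩ := isMild_of_isSolution hg hsol
    filter_upwards [hgG, ae_restrict_mem hI.measurableSet] with t h1 ht
    refine coeff_injective fun n => ?_
    rw [h1, hcoeff t ht]
    exact hG.eq_of_isMild hI hc hF ht n
  · have h00 : (0 : ℝ) ∈ I := ⟨le_rfl, by simp⟩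
    refine coeff_injective fun n => ?_
    dsimp only
    rw [hcoeff 0 h00, duhamel_zero]
  · have := ae_lt_top (measurable_sobolevSum 6 (hF.forcing.continuous_duhamel c)) h6.ne
    filter_upwards [hcoeff', this] with t ht h
    refine ⟨by rw [ht, hU0], ?_⟩
    rw [hdotNorm_lt_top, ht]
    norm_num
    exact h
  · refine lt_of_le_of_lt (lintegral_mono_ae ?_) h6
    filter_upwards [hcoeff'] with t ht
    rw [hdotNorm_rpow_two, ht]
    norm_num
  · intro hreal t ht
    rw [isRealValued_iff] at hreal ⊢
    rw [hcoeff t ht]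
    exact hF.conjCoeff_duhamel hI hc hreal ht

/-! ### Short times and small data -/

theorem timeInterval_ofReal_subset {T : ℝ} (hT : 0 ≤ T) :
    timeInterval (ENNReal.ofReal T) ⊆ Icc 0 T := fun _ ht =>
  ⟨ht.1, (ENNReal.ofReal_le_ofReal_iff hT).1 ht.2⟩

/-- The free evolution has finite `L⁴Ḣ^{9/4}` norm on `[0, ∞)`, so its norm on `[0, T]` is small for
short `T` by absolute continuity of the integral. The time obtained depends on the datum itself, not
only on its norm. -/
theorem exists_uniquelySolvable {f₀ : L2} (hf₀ : MemHdot (3 / 2) f₀) :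
    ∃ T : ℝ, 0 < T ∧ UniquelySolvable (ENNReal.ofReal T) f₀ := by
  have hc : sobolevSum 3 (coeff f₀) < ∞ := by
    have := hdotNorm_lt_top.1 hf₀.2
    norm_num at this
    exact this
  have hfin : ∫⁻ t in timeInterval ⊤, sobolevSum (9 / 2) (free (coeff f₀) t) ^ 2 ≠ ∞ :=
    ((quarticNorm_free_le (isTimeSet_timeInterval ⊤) (coeff f₀)).trans_lt
      (ENNReal.pow_lt_top hc)).ne
  obtain ⟨δ, hδ, hsmall⟩ := exists_pos_setLIntegral_lt_of_measure_lt hfin (ε := 16⁻¹ ^ 4)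
    (by norm_num)
  obtain ⟨q, hq0, hqδ⟩ := ENNReal.lt_iff_exists_nnreal_btwn.1 hδ
  refine ⟨q, by exact_mod_cast hq0, uniquelySolvable_of_quarticNorm_free_le hf₀ ?_⟩
  set J := timeInterval (ENNReal.ofReal q)
  have hJ : J ⊆ timeInterval ⊤ := fun t ht => ⟨ht.1, le_top⟩
  refine le_trans (lintegral_mono' ?_ le_rfl) (hsmall J ?_).le
  · rw [Measure.restrict_restrict (isTimeSet_timeInterval _).measurableSet, inter_eq_left.2 hJ]
  · refine (Measure.restrict_apply_le _ _).trans_lt (lt_of_le_of_lt ?_ hqδ)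
    refine (measure_mono (timeInterval_ofReal_subset q.2)).trans ?_
    rw [Real.volume_Icc]
    simp

theorem uniquelySolvable_top_of_hdotNorm_le {f₀ : L2} (hf₀ : MemHdot (3 / 2) f₀)
    (hsmall : hdotNorm (3 / 2) f₀ ≤ ENNReal.ofReal (1 / 16)) : UniquelySolvable ⊤ f₀ := by
  refine uniquelySolvable_of_quarticNorm_free_le hf₀ ?_
  refine (quarticNorm_free_le (isTimeSet_timeInterval ⊤) _).trans ?_
  have h16 : ENNReal.ofReal (1 / 16) = 16⁻¹ := by
    rw [one_div, ENNReal.ofReal_inv_of_pos (by norm_num)]; norm_num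
  have h := hdotNorm_sq (3 / 2) f₀
  rw [show (2 * (3 / 2) : ℝ) = 3 by norm_num] at h
  rw [← h, ← pow_mul, ← h16]
  gcongr

end CapillaryMuskat

end

theorem theorem1 :
    (∀ f₀ : CapillaryMuskat.L2, CapillaryMuskat.MemHdot (3 / 2) f₀ →
      ∃ T : ℝ, 0 < T ∧ CapillaryMuskat.UniquelySolvable (ENNReal.ofReal T) f₀) ∧
    (∃ ε₀ : ℝ, 0 < ε₀ ∧ ∀ f₀ : CapillaryMuskat.L2, CapillaryMuskat.MemHdot (3 / 2) f₀ →
      CapillaryMuskat.hdotNorm (3 / 2) f₀ ≤ ENNReal.ofReal ε₀ →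
      CapillaryMuskat.UniquelySolvable ⊤ f₀) :=
  ⟨fun _ hf₀ => CapillaryMuskat.exists_uniquelySolvable hf₀, 1 / 16, by norm_num,
    fun _ hf₀ h => CapillaryMuskat.uniquelySolvable_top_of_hdotNorm_le hf₀ h⟩
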